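/- Let $\Theta\subseteq\mathbb{R}^{d}$ be measurable. For each $n$ let $P^{(n)}_0$ be the law of the data, $\overline m_n:\Theta\to\mathbb{R}^d$ a random score function (for instance $n^{-1}$ times the gradient of a loss) and $W_n(\theta)$ a random $d\times d$ matrix function on $\Theta$, both measurable in $\theta$. Let $\pi$ be a probability density on $\Theta$. With $|\cdot|$ the determinant, the Q-posterior is $$\pi(\theta\mid\mathcal Q_n)=\frac{|W_n(\theta)|^{-1/2}\exp\{-\tfrac n2\,\overline m_n(\theta)^\top W_n(\theta)^{-1}\overline m_n(\theta)\}\,\pi(\theta)}{\int_\Theta |W_n(\theta')|^{-1/2}\exp\{-\tfrac n2\,\overline m_n(\theta')^\top W_n(\theta')^{-1}\overline m_n(\theta')\}\,\pi(\theta')\,\mathrm d\theta'}.$$ All $o_p,O_p$ and weak limits are under $P^{(n)}_0$ as $n\to\infty$. Assume the following. **1 (scores).** There are $m:\Theta\to\mathbb{R}^d$ and $\theta_\star\in\mathrm{Int}(\Theta)$ such that: (i) $\sup_{\theta\in\Theta}\|\overline m_n(\theta)-m(\theta)\|=o_p(1)$; (ii) $m(\theta_\star)=0$; (iii) for some $\delta>0$,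 $m$ is continuously differentiable on $\|\theta-\theta_\star\|\le\delta$, and $\mathcal H(\theta_\star):=-\nabla_\theta m(\theta_\star)$ is invertible; (iv) $\sqrt n\,\overline m_n(\theta_\star)\Rightarrow N\{0,\mathcal I\}$ for some positive-definite $\mathcal I$; (v) for every $\epsilon>0$ there is $\delta>0$ with $$\limsup_{n\to\infty}P^{(n)}_0\Big(\sup_{\theta\in\Theta,\ \|\theta-\theta_\star\|<\delta}\frac{\sqrt n\,\|\{\overline m_n(\theta)-\overline m_n(\theta_\star)\}-\{m(\theta)-m(\theta_\star)\}\|}{1+\sqrt n\,\|\theta-\theta_\star\|}>\epsilon\Big)<\epsilon .$$ **2 (weights, identification).** There is a symmetric positive semi-definite matrix function $W(\theta)$, $\theta\in\Theta$, with $\sup_{\theta\in\Theta}\|W_n(\theta)-W(\theta)\|=o_p(1)$. For some $\delta>0$, $W$ is continuous and positive-definite on $\{\theta\in\Theta:\|\theta-\theta_\star\|\le\delta\}$, and, with probability tending to one, $W_n(\theta)$ is symmetric positive semi-definite for all $\theta\in\Theta$ and positive-definite for all $\theta\in\Theta$ with $\|\theta-\theta_\star\|\le\delta$. For every $\epsilon>0$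 there is $\eta>0$ such that $$\inf_{\theta\in\Theta,\ \|\theta-\theta_\star\|\ge\epsilon}m(\theta)^\top\{W(\theta)+\eta I\}^{-1}m(\theta)>0 .$$ **3 (prior).** $\pi$ is continuous on $\Theta$, $\pi(\theta_\star)>0$, and for some real $p\ge1$, $\int_\Theta\|\theta\|^p\pi(\theta)\,\mathrm d\theta<\infty$ and $\int_\Theta|W_n(\theta)|^{-1/2}\|\theta-\theta_\star\|^p\pi(\theta)\,\mathrm d\theta=O_p(1)$, where $|W_n(\theta)|^{-1/2}=\infty$ if $W_n(\theta)$ is singular. Suppose also that $\theta_\star$ is the only zero of $m$ in $\Theta$. Let $\theta_n\in\Theta$ be any random sequence with $\sqrt n\,\overline m_n(\theta_n)=o_p(1)$ (for instance solutions of $\overline m_n(\theta_n)=0$). Put $\vartheta=\sqrt n(\theta-\theta_n)$, $\mathcal T_n=\{\sqrt n(\theta-\theta_n):\theta\in\Theta\}$, $\pi(\vartheta\mid\mathcal Q_n)=n^{-d/2}\,\pi(\theta_n+\vartheta/\sqrt n\mid\mathcal Q_n)$ and $\Delta(\theta_\star)=\mathcal H(\theta_\star)^\top W(\theta_\star)^{-1}\mathcal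 H(\theta_\star)$, which equals $\mathcal H(\theta_\star) W(\theta_\star)^{-1}\mathcal H(\theta_\star)$ when $\mathcal H(\theta_\star)$ is symmetric. Let $N\{\,\cdot\,;0,\Sigma\}$ be the Gaussian density with mean $0$ and variance $\Sigma$. Then, for $k=0$ and $k=1$, $$\int_{\mathcal T_n}\|\vartheta\|^{k}\,\big|\pi(\vartheta\mid\mathcal Q_n)-N\{\vartheta;0,\Delta(\theta_\star)^{-1}\}\big|\,\mathrm d\vartheta=o_p(1).$$ -/

import Mathlib

open MeasureTheory ProbabilityTheory Filter Topology
open scoped Matrix ENNReal Matrix.Norms.L2Operator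

noncomputable section

namespace QPosterior

/-- The quadratic form `xᵀ A x`. -/
def quad {d : ℕ} (A : Matrix (Fin d) (Fin d) ℝ) (x : EuclideanSpace ℝ (Fin d)) : ℝ :=
  x.ofLp ⬝ᵥ (A *ᵥ x.ofLp)

/-- The density `N{x; μ, S}` of the Gaussian law with mean `μ` and positive definite variance `S`. -/
def gaussianDensity {d : ℕ} (μ : EuclideanSpace ℝ (Fin d)) (S : Matrix (Fin d) (Fin d) ℝ)
    (x : EuclideanSpace ℝ (Fin d)) : ℝ :=
  Real.exp (-(quad S⁻¹ (x - μ) / 2)) / Real.sqrt ((2 * Real.pi) ^ d * S.det)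

/-- `X n = o_p(1)` for nonnegative variables on possibly different spaces: `P n (X n > ε) → 0`
for all `ε > 0`. Nothing has to be measurable in the sample: `P n` acts as an outer measure. -/
def IsLittleOp {Ω : ℕ → Type*} [∀ n, MeasurableSpace (Ω n)] (P : ∀ n, Measure (Ω n))
    (X : ∀ n, Ω n → ℝ≥0∞) : Prop :=
  ∀ ε : ℝ, 0 < ε → Tendsto (fun n => P n {y | ENNReal.ofReal ε < X n y}) atTop (𝓝 0)

/-- `X n = O_p(1)` for nonnegative variables on possibly different spaces. -/
def IsBigOp {Ω : ℕ → Type*} [∀ n, MeasurableSpace (Ω n)] (P : ∀ n, Measure (Ω n))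
    (X : ∀ n, Ω n → ℝ≥0∞) : Prop :=
  ∀ ε : ℝ, 0 < ε → ∃ C : ℝ, ∀ᶠ n in atTop,
    P n {y | ENNReal.ofReal C < X n y} ≤ ENNReal.ofReal ε

/-- `|W(θ)|^{-1/2} exp(-n Q(θ)) prior(θ)`, with `|W|` the determinant and
`Q(θ) = m̄(θ)ᵀ W(θ)⁻¹ m̄(θ) / 2`: the unnormalised Q-posterior density for one sample. -/
def kernel {d : ℕ} (n : ℕ)
    (mbar : EuclideanSpace ℝ (Fin d) → EuclideanSpace ℝ (Fin d))
    (W : EuclideanSpace ℝ (Fin d) → Matrix (Fin d) (Fin d) ℝ)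
    (prior : EuclideanSpace ℝ (Fin d) → ℝ) (θ : EuclideanSpace ℝ (Fin d)) : ℝ :=
  (W θ).det ^ (-(1 / 2) : ℝ) * Real.exp (-(n * (quad (W θ)⁻¹ (mbar θ) / 2))) * prior θ

/-- The Q-posterior density of `θ` on the parameter space `Θ`. -/
def density {d : ℕ} (n : ℕ) (Θ : Set (EuclideanSpace ℝ (Fin d)))
    (mbar : EuclideanSpace ℝ (Fin d) → EuclideanSpace ℝ (Fin d))
    (W : EuclideanSpace ℝ (Fin d) → Matrix (Fin d) (Fin d) ℝ)
    (prior : EuclideanSpace ℝ (Fin d) → ℝ) (θ : EuclideanSpace ℝ (Fin d)) : ℝ :=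
  kernel n mbar W prior θ / ∫ θ' in Θ, kernel n mbar W prior θ'

/-- The Q-posterior density of the local parameter `t = √n (θ - θₙ)`. -/
def localDensity {d : ℕ} (n : ℕ) (Θ : Set (EuclideanSpace ℝ (Fin d)))
    (mbar : EuclideanSpace ℝ (Fin d) → EuclideanSpace ℝ (Fin d))
    (W : EuclideanSpace ℝ (Fin d) → Matrix (Fin d) (Fin d) ℝ)
    (prior : EuclideanSpace ℝ (Fin d) → ℝ)
    (θn t : EuclideanSpace ℝ (Fin d)) : ℝ :=
  density n Θ mbar W prior (θn + (Real.sqrt n)⁻¹ • t) / (n : ℝ) ^ ((d : ℝ) / 2)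

/-- The set of values of the local parameter. -/
def localSpace {d : ℕ} (n : ℕ) (Θ : Set (EuclideanSpace ℝ (Fin d)))
    (θn : EuclideanSpace ℝ (Fin d)) : Set (EuclideanSpace ℝ (Fin d)) :=
  (fun θ => Real.sqrt n • (θ - θn)) '' Θ

/-- `H(θ) = -∇ m(θ)`, with entries `-∂ mᵢ / ∂ θⱼ`. -/
def negJacobian {d : ℕ} (m : EuclideanSpace ℝ (Fin d) → EuclideanSpace ℝ (Fin d))
    (θ : EuclideanSpace ℝ (Fin d)) : Matrix (Fin d) (Fin d) ℝ :=
  Matrix.of fun i j => -(fderiv ℝ m θ (EuclideanSpace.single j 1)) i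

/-- `Δ(θ) = H(θ)ᵀ W(θ)⁻¹ H(θ)`. -/
def precision {d : ℕ} (m : EuclideanSpace ℝ (Fin d) → EuclideanSpace ℝ (Fin d))
    (W : EuclideanSpace ℝ (Fin d) → Matrix (Fin d) (Fin d) ℝ)
    (θ : EuclideanSpace ℝ (Fin d)) : Matrix (Fin d) (Fin d) ℝ :=
  (negJacobian m θ)ᵀ * (W θ)⁻¹ * negJacobian m θ

/-- Regularity of the scores `m̄ₙ` and of their limit `m` at `θs`. -/
structure ScoreRegular {d : ℕ} {Ω : ℕ → Type*} [∀ n, MeasurableSpace (Ω n)]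
    (P : ∀ n, Measure (Ω n)) [∀ n, IsProbabilityMeasure (P n)]
    (Θ : Set (EuclideanSpace ℝ (Fin d)))
    (mbar : ∀ n, Ω n → EuclideanSpace ℝ (Fin d) → EuclideanSpace ℝ (Fin d))
    (m : EuclideanSpace ℝ (Fin d) → EuclideanSpace ℝ (Fin d))
    (θs : EuclideanSpace ℝ (Fin d)) : Prop where
  /-- Uniform law of large numbers. -/
  ulln : IsLittleOp P fun n y => ⨆ θ ∈ Θ, ‖mbar n y θ - m θ‖ₑ
  mem_interior : θs ∈ interior Θ
  root : m θs = 0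
  contDiff : ∃ δ > 0, ContDiffOn ℝ 1 m (Metric.closedBall θs δ)
  invertible : IsUnit (negJacobian m θs)
  /-- Central limit theorem at `θs`. -/
  clt : ∃ I : Matrix (Fin d) (Fin d) ℝ, I.PosDef ∧
    TendstoInDistribution (fun (n : ℕ) (y : Ω n) => Real.sqrt n • mbar n y θs) atTop
      (id : EuclideanSpace ℝ (Fin d) → EuclideanSpace ℝ (Fin d)) P (multivariateGaussian 0 I)
  /-- Stochastic equicontinuity at `θs`. -/
  equicont : ∀ ε : ℝ, 0 < ε → ∃ δ > 0,
    limsup (fun n : ℕ => P n {y | ENNReal.ofReal ε < ⨆ θ ∈ Θ ∩ Metric.ball θs δ,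
      ENNReal.ofReal (Real.sqrt n * ‖(mbar n y θ - mbar n y θs) - (m θ - m θs)‖ /
        (1 + Real.sqrt n * ‖θ - θs‖))}) atTop < ENNReal.ofReal ε

/-- Regularity of the weight matrices `Wₙ` and of their limit `W`, and identification of `θs`.
Since `W` may be singular, and arbitrarily close to singular, away from `θs`, the form
`m(θ)ᵀ W(θ)⁻¹ m(θ)` in the identification condition is taken with `W(θ)` replaced by
`W(θ) + η I`, for some `η > 0`. -/
structure WeightRegular {d : ℕ} {Ω : ℕ → Type*} [∀ n, MeasurableSpace (Ω n)]
    (P : ∀ n, Measure (Ω n)) (Θ : Set (EuclideanSpace ℝ (Fin d)))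
    (Wn : ∀ n, Ω n → EuclideanSpace ℝ (Fin d) → Matrix (Fin d) (Fin d) ℝ)
    (m : EuclideanSpace ℝ (Fin d) → EuclideanSpace ℝ (Fin d))
    (W : EuclideanSpace ℝ (Fin d) → Matrix (Fin d) (Fin d) ℝ)
    (θs : EuclideanSpace ℝ (Fin d)) : Prop where
  near : ∃ δ > 0,
    Tendsto (fun n => P n {y | ¬ ((∀ θ ∈ Θ, (Wn n y θ).PosSemidef) ∧
      ∀ θ ∈ Θ ∩ Metric.closedBall θs δ, (Wn n y θ).PosDef)}) atTop (𝓝 0) ∧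
    ContinuousOn W (Θ ∩ Metric.closedBall θs δ) ∧
    ∀ θ ∈ Θ ∩ Metric.closedBall θs δ, (W θ).PosDef
  posSemidef : ∀ θ ∈ Θ, (W θ).PosSemidef
  /-- Uniform consistency. -/
  consistent : IsLittleOp P fun n y => ⨆ θ ∈ Θ, ‖Wn n y θ - W θ‖ₑ
  /-- Identification. -/
  identified : ∀ ε : ℝ, 0 < ε → ∃ η > 0, ∃ c > 0, ∀ θ ∈ Θ, ε ≤ ‖θ - θs‖ →
    c ≤ quad (W θ + η • (1 : Matrix (Fin d) (Fin d) ℝ))⁻¹ (m θ)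

/-- Conditions on the prior density, with moment order `p`. In `moment_weighted` the factor
`|Wₙ(θ)|^{-1/2}` is `∞` where `Wₙ(θ)` is singular. -/
structure PriorRegular {d : ℕ} {Ω : ℕ → Type*} [∀ n, MeasurableSpace (Ω n)]
    (P : ∀ n, Measure (Ω n)) (Θ : Set (EuclideanSpace ℝ (Fin d)))
    (Wn : ∀ n, Ω n → EuclideanSpace ℝ (Fin d) → Matrix (Fin d) (Fin d) ℝ)
    (prior : EuclideanSpace ℝ (Fin d) → ℝ) (p : ℝ)
    (θs : EuclideanSpace ℝ (Fin d)) : Prop where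
  nonneg : ∀ θ ∈ Θ, 0 ≤ prior θ
  total : ∫ θ in Θ, prior θ = 1
  continuousOn : ContinuousOn prior Θ
  pos : 0 < prior θs
  one_le : 1 ≤ p
  moment : ∫⁻ θ in Θ, ENNReal.ofReal (‖θ‖ ^ p * prior θ) < ∞
  moment_weighted : IsBigOp P fun n y =>
    ∫⁻ θ in Θ, ENNReal.ofReal (Wn n y θ).det ^ (-(1 / 2) : ℝ) *
      ENNReal.ofReal (‖θ - θs‖ ^ p * prior θ)

end QPosterior

end

noncomputable section

namespace QPosterior

/-! ### Quadratic forms -/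

section QuadraticForms

variable {d : ℕ}

/-! Near `θs` the score linearises around the centring point: as `√n m̄ₙ(θₙ)` is negligible,
equicontinuity and differentiability of `m` give `√n m̄ₙ(θ) ≈ -H t`, where `t = √n (θ - θₙ)`, with
an error small relative to `1 + ‖t‖` (`eventually_norm_sqrt_smul_sub_le`). The exponent then tends
to `-tᵀ Δ t / 2`, while the determinant and prior factors become constants. The same expansion gives
Gaussian domination on a fixed ball (`exists_abs_kernel_le`), hence weighted `L¹` convergence there.
The central limit theorem enters only as tightness, which makes `θₙ` root-`n` consistent.

Away from `θs` the weights may degenerate, so their inverses are not compared. Instead `xᵀ V⁻¹ x =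
sup_y (2 xᵀ y - yᵀ V y)` is tested at `y = (W + η I)⁻¹ m`, which needs only `V ≤ W + η I`
(`half_quad_regularised_sub_le`). This carries identification over to the sample, and the
exponential factor beats the powers of `n` in front of the weighted prior moment
(`tendsto_lintegral_far`). Normalising is harmless (`tendsto_lintegral_normalised`).

All of this is done along a fixed sequence of outcomes (`RegularPath`). If convergence in
probability failed, the bad event would keep outer probability above some `a > 0` infinitely often,
while the assumptions, at countably many accuracy levels, fail with total probability at most `a`.
Some path is then bad and regular, a contradiction (`exists_path_of_frequently`). Subadditivity
suffices, so nothing need be measurable in the sample. -/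

theorem quad_eq_inner (A : Matrix (Fin d) (Fin d) ℝ) (x : EuclideanSpace ℝ (Fin d)) :
    quad A x = inner ℝ x (WithLp.toLp 2 (A *ᵥ x.ofLp)) := by
  simp [quad, EuclideanSpace.inner_eq_star_dotProduct, dotProduct_comm]

theorem norm_toLp_mulVec_le (A : Matrix (Fin d) (Fin d) ℝ) (x : EuclideanSpace ℝ (Fin d)) :
    ‖(WithLp.toLp 2 (A *ᵥ x.ofLp) : EuclideanSpace ℝ (Fin d))‖ ≤ ‖A‖ * ‖x‖ :=
  Matrix.l2_opNorm_mulVec A x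

theorem abs_quad_le (A : Matrix (Fin d) (Fin d) ℝ) (x : EuclideanSpace ℝ (Fin d)) :
    |quad A x| ≤ ‖A‖ * ‖x‖ ^ 2 := by
  rw [quad_eq_inner]
  refine (abs_real_inner_le_norm _ _).trans ?_
  nlinarith [mul_le_mul_of_nonneg_left (norm_toLp_mulVec_le A x) (norm_nonneg x)]

theorem quad_sub_left (A B : Matrix (Fin d) (Fin d) ℝ) (x : EuclideanSpace ℝ (Fin d)) :
    quad (A - B) x = quad A x - quad B x := by
  simp [quad, Matrix.sub_mulVec, dotProduct_sub]

theorem quad_add_smul_one (A : Matrix (Fin d) (Fin d) ℝ) (η : ℝ)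
    (x : EuclideanSpace ℝ (Fin d)) :
    quad (A + η • (1 : Matrix (Fin d) (Fin d) ℝ)) x = quad A x + η * ‖x‖ ^ 2 := by
  rw [← real_inner_self_eq_norm_sq, EuclideanSpace.inner_eq_star_dotProduct]
  simp [quad, Matrix.add_mulVec, dotProduct_add, Matrix.smul_mulVec]

theorem quad_smul (A : Matrix (Fin d) (Fin d) ℝ) (c : ℝ) (x : EuclideanSpace ℝ (Fin d)) :
    quad A (c • x) = c ^ 2 * quad A x := by
  simp [quad, Matrix.mulVec_smul]; ring

theorem quad_neg (A : Matrix (Fin d) (Fin d) ℝ) (x : EuclideanSpace ℝ (Fin d)) :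
    quad A (-x) = quad A x := by
  simp [quad, Matrix.mulVec_neg]

theorem quad_transpose_mul_mul (A B : Matrix (Fin d) (Fin d) ℝ) (x : EuclideanSpace ℝ (Fin d)) :
    quad (Bᵀ * A * B) x = quad A (WithLp.toLp 2 (B *ᵥ x.ofLp)) := by
  simp only [quad, ← Matrix.mulVec_mulVec]
  rw [Matrix.dotProduct_mulVec, Matrix.vecMul_transpose]

theorem quad_nonneg {A : Matrix (Fin d) (Fin d) ℝ} (hA : A.PosSemidef)
    (x : EuclideanSpace ℝ (Fin d)) : 0 ≤ quad A x := by
  simpa [quad] using hA.dotProduct_mulVec_nonneg x.ofLp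

theorem continuous_quad : Continuous fun z : Matrix (Fin d) (Fin d) ℝ ×
    EuclideanSpace ℝ (Fin d) => quad z.1 z.2 := by
  unfold quad
  fun_prop

/-- The variational lower bound for the quadratic form of an inverse. -/
theorem two_mul_dotProduct_sub_quad_le {A : Matrix (Fin d) (Fin d) ℝ} (hA : A.PosDef)
    (x y : EuclideanSpace ℝ (Fin d)) :
    2 * (x.ofLp ⬝ᵥ y.ofLp) - quad A y ≤ quad A⁻¹ x := by
  -- Completing the square: this form is exactly the gap in the inequality.
  have h := quad_nonneg hA.posSemidef (WithLp.toLp 2 (A⁻¹ *ᵥ x.ofLp) - y)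
  have hu : IsUnit A.det := (Matrix.isUnit_iff_isUnit_det _).1 hA.isUnit
  have hT : Aᵀ = A := by simpa using hA.isHermitian.eq
  have h1 : A *ᵥ (A⁻¹ *ᵥ x.ofLp) = x.ofLp := by
    rw [Matrix.mulVec_mulVec, Matrix.mul_nonsing_inv _ hu, Matrix.one_mulVec]
  have h2 : (A⁻¹ *ᵥ x.ofLp) ⬝ᵥ (A *ᵥ y.ofLp) = x.ofLp ⬝ᵥ y.ofLp := by
    rw [Matrix.dotProduct_mulVec, ← Matrix.mulVec_transpose, hT, h1]
  simp only [quad, WithLp.ofLp_sub, Matrix.mulVec_sub, sub_dotProduct, dotProduct_sub, h1, h2]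
    at h ⊢
  rw [dotProduct_comm (A⁻¹ *ᵥ x.ofLp), dotProduct_comm y.ofLp x.ofLp] at h
  linarith

/-- If `V` is close to `W` and `x` to `m`, the form `xᵀ V⁻¹ x` is bounded below in terms of the
regularised form `mᵀ (W + η I)⁻¹ m`. -/
theorem half_quad_regularised_sub_le {V W : Matrix (Fin d) (Fin d) ℝ} {η e : ℝ} (hη : 0 < η)
    (hV : V.PosDef) (hW : W.PosSemidef) (hVW : ‖V - W‖ ≤ η)
    {x m : EuclideanSpace ℝ (Fin d)} (hx : ‖x - m‖ ≤ e) :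
    quad (W + η • (1 : Matrix (Fin d) (Fin d) ℝ))⁻¹ m / 2 - 2 * e ^ 2 / η ≤ quad V⁻¹ x := by
  set U := W + η • (1 : Matrix (Fin d) (Fin d) ℝ) with hU
  have hUpd : U.PosDef := Matrix.PosDef.posSemidef_add hW (Matrix.PosDef.one.smul hη)
  have hu : IsUnit U.det := (Matrix.isUnit_iff_isUnit_det _).1 hUpd.isUnit
  -- The maximiser of `2 mᵀ y - yᵀ U y`, used as test vector for `V`.
  set y : EuclideanSpace ℝ (Fin d) := WithLp.toLp 2 (U⁻¹ *ᵥ m.ofLp) with hy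
  have hUy : U *ᵥ y.ofLp = m.ofLp := by
    simp [hy, Matrix.mulVec_mulVec, Matrix.mul_nonsing_inv _ hu]
  have hQ : quad U⁻¹ m = m.ofLp ⬝ᵥ y.ofLp := rfl
  have hQ' : quad U y = m.ofLp ⬝ᵥ y.ofLp := by rw [quad, hUy, dotProduct_comm]
  have h1 := two_mul_dotProduct_sub_quad_le hV x y
  have h2 : quad V y ≤ quad U y := by
    have := (abs_le.1 (abs_quad_le (V - W) y)).2
    rw [quad_sub_left] at this
    rw [hU, quad_add_smul_one]
    nlinarith [mul_le_mul_of_nonneg_right hVW (sq_nonneg ‖y‖)]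
  have h3 : η * ‖y‖ ^ 2 ≤ quad U y := by
    rw [hU, quad_add_smul_one]
    linarith [quad_nonneg hW y]
  have h4 : x.ofLp ⬝ᵥ y.ofLp - m.ofLp ⬝ᵥ y.ofLp = inner ℝ y (x - m) := by
    rw [EuclideanSpace.inner_eq_star_dotProduct]
    simp [sub_dotProduct]
  have h5 : -(‖y‖ * e) ≤ inner ℝ y (x - m) := by
    have := (abs_le.1 (abs_real_inner_le_norm y (x - m))).1
    nlinarith [mul_le_mul_of_nonneg_left hx (norm_nonneg y)]
  -- Young's inequality, weighted so that the `‖y‖²` term costs only half of `quad U y`.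
  have h6 : 2 * (‖y‖ * e) ≤ η * ‖y‖ ^ 2 / 2 + 2 * e ^ 2 / η := by
    have : η * ‖y‖ ^ 2 / 2 + 2 * e ^ 2 / η - 2 * (‖y‖ * e) = (η * ‖y‖ - 2 * e) ^ 2 / (2 * η) := by
      field_simp; ring
    have h7 : 0 ≤ (η * ‖y‖ - 2 * e) ^ 2 / (2 * η) := by positivity
    linarith
  rw [hQ]
  rw [hQ'] at h2 h3
  linarith

theorem _root_.Matrix.PosDef.exists_eq_transpose_mul_self {A : Matrix (Fin d) (Fin d) ℝ}
    (hA : A.PosDef) : ∃ B : Matrix (Fin d) (Fin d) ℝ, B.det ≠ 0 ∧ A = Bᵀ * B := by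
  open scoped MatrixOrder in
  obtain ⟨B, hB⟩ := CStarAlgebra.nonneg_iff_eq_star_mul_self.1 hA.posSemidef.nonneg
  have hB' : A = Bᵀ * B := by
    simpa [Matrix.star_eq_conjTranspose, Matrix.conjTranspose_eq_transpose_of_trivial] using hB
  refine ⟨B, fun h => hA.det_pos.ne' ?_, hB'⟩
  rw [hB', Matrix.det_mul, h, mul_zero]

theorem quad_transpose_mul_self (B : Matrix (Fin d) (Fin d) ℝ) (x : EuclideanSpace ℝ (Fin d)) :
    quad (Bᵀ * B) x = ‖(WithLp.toLp 2 (B *ᵥ x.ofLp) : EuclideanSpace ℝ (Fin d))‖ ^ 2 := by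
  have := quad_transpose_mul_mul 1 B x
  rw [mul_one] at this
  rw [this, ← real_inner_self_eq_norm_sq, quad_eq_inner]
  simp

theorem exists_norm_le_norm_mulVec {B : Matrix (Fin d) (Fin d) ℝ} (hB : IsUnit B) :
    ∃ c > 0, ∀ x : EuclideanSpace ℝ (Fin d),
      c * ‖x‖ ≤ ‖(WithLp.toLp 2 (B *ᵥ x.ofLp) : EuclideanSpace ℝ (Fin d))‖ := by
  -- The `+ 1` covers `d = 0`, where `‖B⁻¹‖ = 0`.
  refine ⟨(‖B⁻¹‖ + 1)⁻¹, by positivity, fun x => ?_⟩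
  have h := norm_toLp_mulVec_le B⁻¹ (WithLp.toLp 2 (B *ᵥ x.ofLp))
  have hu : IsUnit B.det := (Matrix.isUnit_iff_isUnit_det _).1 hB
  simp only [Matrix.mulVec_mulVec, Matrix.nonsing_inv_mul _ hu, Matrix.one_mulVec] at h
  rw [inv_mul_le_iff₀ (by positivity)]
  refine h.trans ?_
  gcongr
  linarith

theorem exists_mul_norm_sq_le_quad {A : Matrix (Fin d) (Fin d) ℝ} (hA : A.PosDef) :
    ∃ a > 0, ∀ x : EuclideanSpace ℝ (Fin d), a * ‖x‖ ^ 2 ≤ quad A x := by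
  obtain ⟨B, hB, rfl⟩ := hA.exists_eq_transpose_mul_self
  obtain ⟨c, hc, h⟩ := exists_norm_le_norm_mulVec ((Matrix.isUnit_iff_isUnit_det _).2 hB.isUnit)
  refine ⟨c ^ 2, by positivity, fun x => ?_⟩
  rw [quad_transpose_mul_self, ← mul_pow]
  have := h x
  gcongr

theorem continuousAt_matrix_inv {A : Matrix (Fin d) (Fin d) ℝ} (hA : IsUnit A) :
    ContinuousAt (fun B : Matrix (Fin d) (Fin d) ℝ => B⁻¹) A := by
  obtain ⟨u, rfl⟩ := hA
  simpa only [Matrix.nonsing_inv_eq_ringInverse] using NormedRing.inverse_continuousAt u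

end QuadraticForms

/-! ### Gaussian integrals -/

section Gaussian

variable {d : ℕ}

/-- Read off from the closed form: a nonintegrable function would have integral `0`, but the
Gaussian integral is positive. -/
theorem integrable_exp_neg_mul_norm_sq {b : ℝ} (hb : 0 < b) :
    Integrable fun x : EuclideanSpace ℝ (Fin d) => Real.exp (-b * ‖x‖ ^ 2) := by
  by_contra h
  have h1 := GaussianFourier.integral_rexp_neg_mul_sq_norm (V := EuclideanSpace ℝ (Fin d)) hb
  rw [integral_undef h] at h1
  have : 0 < (Real.pi / b) ^ ((Module.finrank ℝ (EuclideanSpace ℝ (Fin d)) : ℝ) / 2) := by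
    positivity
  linarith

/-- By `1 + r ≤ exp r` and completing the square, the factor costs half of the exponent and the
constant `exp (1 / (2b))`. -/
theorem integrable_one_add_norm_mul_exp_neg_mul_norm_sq {b : ℝ} (hb : 0 < b) :
    Integrable fun x : EuclideanSpace ℝ (Fin d) => (1 + ‖x‖) * Real.exp (-b * ‖x‖ ^ 2) := by
  refine ((integrable_exp_neg_mul_norm_sq (d := d) (half_pos hb)).const_mul
    (Real.exp (1 / (2 * b)))).mono' (by fun_prop) (ae_of_all _ fun x => ?_)
  rw [Real.norm_of_nonneg (by positivity), ← Real.exp_add]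
  have h1 : 1 + ‖x‖ ≤ Real.exp ‖x‖ := by linarith [Real.add_one_le_exp ‖x‖]
  refine (mul_le_mul_of_nonneg_right h1 (Real.exp_pos _).le).trans ?_
  rw [← Real.exp_add]
  apply Real.exp_le_exp.2
  have h2 : 1 / (2 * b) + -(b / 2) * ‖x‖ ^ 2 - (‖x‖ + -b * ‖x‖ ^ 2)
      = (b * ‖x‖ - 1) ^ 2 / (2 * b) := by field_simp; ring
  have h3 : 0 ≤ (b * ‖x‖ - 1) ^ 2 / (2 * b) := by positivity
  linarith

theorem gaussianDensity_zero_inv_eq (A : Matrix (Fin d) (Fin d) ℝ) (hA : A.PosDef)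
    (x : EuclideanSpace ℝ (Fin d)) : gaussianDensity 0 A⁻¹ x =
      Real.exp (-(quad A x / 2)) * (Real.sqrt A.det / (2 * Real.pi) ^ ((d : ℝ) / 2)) := by
  have hu : IsUnit A.det := (Matrix.isUnit_iff_isUnit_det _).1 hA.isUnit
  have hpi : Real.sqrt ((2 * Real.pi) ^ d) = (2 * Real.pi) ^ ((d : ℝ) / 2) := by
    rw [Real.sqrt_eq_rpow, ← Real.rpow_natCast, ← Real.rpow_mul (by positivity)]
    congr 1; ring
  rw [gaussianDensity, sub_zero, Matrix.nonsing_inv_nonsing_inv _ hu, Matrix.det_nonsing_inv,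
    Ring.inverse_eq_inv', Real.sqrt_mul (by positivity), Real.sqrt_inv, hpi]
  field_simp

/-- Writing `A = Bᵀ B`, the substitution `y = B x` reduces this to the standard Gaussian, with
Jacobian `|det B| = √(det A)`. -/
theorem integral_exp_neg_quad_div_two {A : Matrix (Fin d) (Fin d) ℝ} (hA : A.PosDef) :
    ∫ x : EuclideanSpace ℝ (Fin d), Real.exp (-(quad A x / 2)) =
      (2 * Real.pi) ^ ((d : ℝ) / 2) / Real.sqrt A.det := by
  obtain ⟨B, hB, rfl⟩ := hA.exists_eq_transpose_mul_self
  set f : EuclideanSpace ℝ (Fin d) →ₗ[ℝ] EuclideanSpace ℝ (Fin d) := Matrix.toLpLin 2 2 B with hf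
  have hdet : LinearMap.det f = B.det := by rw [hf, LinearMap.det_toLpLin]
  have hfx : ∀ x, f x = WithLp.toLp 2 (B *ᵥ x.ofLp) := fun x => rfl
  have hmap := Measure.map_linearMap_addHaar_eq_smul_addHaar
    (volume : Measure (EuclideanSpace ℝ (Fin d))) (f := f) (by rwa [hdet])
  have h1 := GaussianFourier.integral_rexp_neg_mul_sq_norm (V := EuclideanSpace ℝ (Fin d))
    (b := 1 / 2) (by norm_num)
  have h2 : ∫ y, Real.exp (-(1 / 2) * ‖y‖ ^ 2) ∂(Measure.map f volume) =
      ∫ x : EuclideanSpace ℝ (Fin d), Real.exp (-(quad (Bᵀ * B) x / 2)) := by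
    rw [integral_map f.continuous_of_finiteDimensional.aemeasurable (by fun_prop)]
    refine integral_congr_ae (ae_of_all _ fun x => ?_)
    simp only [quad_transpose_mul_self, hfx]
    congr 1; ring
  rw [← h2, hmap, integral_smul_measure, h1, hdet, ENNReal.toReal_ofReal (abs_nonneg _),
    Matrix.det_mul, Matrix.det_transpose, Real.sqrt_mul_self_eq_abs, abs_inv, finrank_euclideanSpace,
    Fintype.card_fin, smul_eq_mul]
  rw [show Real.pi / (1 / 2) = 2 * Real.pi by ring]
  field_simp

theorem integral_gaussianDensity_zero_inv {A : Matrix (Fin d) (Fin d) ℝ} (hA : A.PosDef) :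
    ∫ x, gaussianDensity 0 A⁻¹ x = 1 := by
  simp_rw [gaussianDensity_zero_inv_eq A hA]
  rw [integral_mul_const, integral_exp_neg_quad_div_two hA]
  have := Real.sqrt_pos.2 hA.det_pos
  field_simp

theorem integrable_one_add_norm_mul_exp_neg_quad {A : Matrix (Fin d) (Fin d) ℝ} (hA : A.PosDef) :
    Integrable fun x : EuclideanSpace ℝ (Fin d) => (1 + ‖x‖) * Real.exp (-(quad A x / 2)) := by
  obtain ⟨a, ha, h⟩ := exists_mul_norm_sq_le_quad hA
  have hq : Continuous fun x : EuclideanSpace ℝ (Fin d) => quad A x :=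
    continuous_quad.comp (continuous_const.prodMk continuous_id)
  refine (integrable_one_add_norm_mul_exp_neg_mul_norm_sq (d := d) (half_pos ha)).mono'
    (by fun_prop) (ae_of_all _ fun x => ?_)
  rw [Real.norm_of_nonneg (by positivity)]
  gcongr
  linarith [h x]

end Gaussian

/-! ### Rescaling and normalisation of integrals -/

section Integrals

variable {d : ℕ}

theorem map_add_inv_smul_volume {s : ℝ} (hs : 0 < s) (τ : EuclideanSpace ℝ (Fin d)) :
    Measure.map (fun t : EuclideanSpace ℝ (Fin d) => τ + s⁻¹ • t) volume =
      ENNReal.ofReal (s ^ d) • volume := by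
  have h : (fun t : EuclideanSpace ℝ (Fin d) => τ + s⁻¹ • t) = (τ + ·) ∘ (s⁻¹ • ·) := rfl
  rw [h, ← Measure.map_map (by fun_prop) (by fun_prop),
    Measure.map_addHaar_smul _ (inv_ne_zero hs.ne'), Measure.map_smul, map_add_left_eq_self]
  simp [abs_of_pos hs]

theorem measurableEmbedding_add_inv_smul {s : ℝ} (hs : 0 < s) (τ : EuclideanSpace ℝ (Fin d)) :
    MeasurableEmbedding (fun t : EuclideanSpace ℝ (Fin d) => τ + s⁻¹ • t) :=
  ((Homeomorph.smulOfNeZero s⁻¹ (inv_ne_zero hs.ne')).trans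
    (Homeomorph.addLeft τ)).measurableEmbedding

theorem lintegral_comp_add_inv_smul {s : ℝ} (hs : 0 < s) (τ : EuclideanSpace ℝ (Fin d))
    (f : EuclideanSpace ℝ (Fin d) → ℝ≥0∞) :
    ∫⁻ t, f (τ + s⁻¹ • t) = ENNReal.ofReal (s ^ d) * ∫⁻ θ, f θ := by
  rw [← (measurableEmbedding_add_inv_smul hs τ).lintegral_map, map_add_inv_smul_volume hs,
    lintegral_smul_measure, smul_eq_mul]

theorem integral_comp_add_inv_smul {s : ℝ} (hs : 0 < s) (τ : EuclideanSpace ℝ (Fin d))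
    (f : EuclideanSpace ℝ (Fin d) → ℝ) :
    ∫ t, f (τ + s⁻¹ • t) = s ^ d * ∫ θ, f θ := by
  rw [← (measurableEmbedding_add_inv_smul hs τ).integral_map f, map_add_inv_smul_volume hs,
    integral_smul_measure, ENNReal.toReal_ofReal (by positivity), smul_eq_mul]

theorem aemeasurable_comp_add_inv_smul {s : ℝ} (hs : 0 < s) (τ : EuclideanSpace ℝ (Fin d))
    {f : EuclideanSpace ℝ (Fin d) → ℝ} (hf : AEMeasurable f) :
    AEMeasurable fun t => f (τ + s⁻¹ • t) := by
  refine AEMeasurable.comp_measurable ?_ (measurableEmbedding_add_inv_smul hs τ).measurable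
  rw [map_add_inv_smul_volume hs]
  exact hf.smul_measure _

/-- Weighted `L¹` convergence of unnormalised densities gives weighted `L¹` convergence of the
normalised ones. -/
theorem tendsto_lintegral_normalised {α : Type*} [MeasurableSpace α] {μ : Measure α}
    {f : ℕ → α → ℝ} {g v w : α → ℝ} {c : ℝ} (hc : 0 < c)
    (hf : ∀ᶠ k in atTop, AEStronglyMeasurable (f k) μ) (hg : Integrable g μ)
    (hg1 : ∫ x, g x ∂μ = 1) (hw : ∀ x, 1 ≤ w x)
    (hwg : Integrable (fun x => w x * |g x|) μ) (hvw : ∀ x, v x ≤ w x)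
    (h : Tendsto (fun k => ∫⁻ x, ENNReal.ofReal (w x * |f k x - c * g x|) ∂μ) atTop (𝓝 0)) :
    Tendsto (fun k => ∫⁻ x, ENNReal.ofReal (v x * |f k x / (∫ y, f k y ∂μ) - g x|) ∂μ)
      atTop (𝓝 0) := by
  have hle : ∀ k, ∫⁻ x, ‖f k x - c * g x‖ₑ ∂μ ≤
      ∫⁻ x, ENNReal.ofReal (w x * |f k x - c * g x|) ∂μ := fun k => by
    refine lintegral_mono fun x => ?_
    rw [← ofReal_norm, Real.norm_eq_abs]
    exact ENNReal.ofReal_le_ofReal (le_mul_of_one_le_left (abs_nonneg _) (hw x))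
  have h1 : Tendsto (fun k => ∫⁻ x, ‖f k x - c * g x‖ₑ ∂μ) atTop (𝓝 0) :=
    tendsto_of_tendsto_of_tendsto_of_le_of_le tendsto_const_nhds h (fun _ => zero_le) hle
  have hcg : Integrable (fun x => c * g x) μ := hg.const_mul c
  have hint : ∀ᶠ k in atTop, Integrable (f k) μ := by
    filter_upwards [hf, h1.eventually_lt_const ENNReal.zero_lt_top] with k hk hk'
    have : Integrable (fun x => f k x - c * g x) μ :=
      ⟨hk.sub hcg.aestronglyMeasurable, hk'⟩
    exact (this.add hcg).congr (ae_of_all _ fun x => by simp)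
  -- Since `1 ≤ w`, plain `L¹` convergence holds and forces the normalising constants to converge to
  -- `c`.
  have hZ : Tendsto (fun k => ∫ y, f k y ∂μ) atTop (𝓝 c) := by
    have := tendsto_integral_of_L1 _ hcg.aestronglyMeasurable hint h1
    rwa [integral_const_mul, hg1, mul_one] at this
  have hZpos : ∀ᶠ k in atTop, 0 < ∫ y, f k y ∂μ := hZ.eventually_const_lt hc
  set I := ∫⁻ x, ENNReal.ofReal (w x * |g x|) ∂μ with hI
  have hIfin : I ≠ ∞ := (hwg.lintegral_lt_top).ne
  have hup : ∀ᶠ k in atTop,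
      ∫⁻ x, ENNReal.ofReal (v x * |f k x / (∫ y, f k y ∂μ) - g x|) ∂μ ≤
        ENNReal.ofReal (∫ y, f k y ∂μ)⁻¹ *
          (∫⁻ x, ENNReal.ofReal (w x * |f k x - c * g x|) ∂μ) +
        ENNReal.ofReal |c / (∫ y, f k y ∂μ) - 1| * I := by
    filter_upwards [hZpos, hf] with k hk hfk
    set Z := ∫ y, f k y ∂μ
    rw [hI, ← lintegral_const_mul' _ _ ENNReal.ofReal_ne_top,
      ← lintegral_const_mul' _ _ ENNReal.ofReal_ne_top, ← lintegral_add_right']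
    · refine lintegral_mono fun x => ?_
      rw [← ENNReal.ofReal_mul (by positivity), ← ENNReal.ofReal_mul (by positivity),
        ← ENNReal.ofReal_add]
      · apply ENNReal.ofReal_le_ofReal
        have hw0 : 0 ≤ w x := zero_le_one.trans (hw x)
        -- Separates the error of the numerator from that of the normalising constant.
        have h3 : f k x / Z - g x = Z⁻¹ * (f k x - c * g x) + (c / Z - 1) * g x := by
          field_simp; ring
        calc v x * |f k x / Z - g x| ≤ w x * |f k x / Z - g x| := by gcongr; exact hvw x
          _ ≤ w x * (Z⁻¹ * |f k x - c * g x| + |c / Z - 1| * |g x|) := by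
            gcongr
            rw [h3]
            refine (abs_add_le _ _).trans ?_
            rw [abs_mul, abs_mul, abs_of_pos (inv_pos.2 hk)]
          _ = _ := by ring
      · have := zero_le_one.trans (hw x); positivity
      · have := zero_le_one.trans (hw x); positivity
    · exact (hwg.aestronglyMeasurable.aemeasurable.ennreal_ofReal).const_mul _
  refine tendsto_of_tendsto_of_tendsto_of_le_of_le' tendsto_const_nhds ?_
    (Eventually.of_forall fun _ => zero_le) hup
  have hA : Tendsto (fun k => ENNReal.ofReal (∫ y, f k y ∂μ)⁻¹ *
      (∫⁻ x, ENNReal.ofReal (w x * |f k x - c * g x|) ∂μ)) atTop (𝓝 0) := by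
    have := ENNReal.Tendsto.mul (ENNReal.tendsto_ofReal (hZ.inv₀ hc.ne'))
      (Or.inr ENNReal.zero_ne_top) h (Or.inr ENNReal.ofReal_ne_top)
    simpa using this
  have hB : Tendsto (fun k => ENNReal.ofReal |c / (∫ y, f k y ∂μ) - 1| * I) atTop (𝓝 0) := by
    have h4 : Tendsto (fun k => |c / (∫ y, f k y ∂μ) - 1|) atTop (𝓝 0) := by
      have := ((tendsto_const_nhds (x := c)).div hZ hc.ne').sub_const 1 |>.abs
      simpa [div_self hc.ne'] using this
    have := ENNReal.Tendsto.mul_const (ENNReal.tendsto_ofReal h4) (Or.inr hIfin)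
    simpa using this
  simpa using hA.add hB

theorem aemeasurable_kernel {n : ℕ} {Θ : Set (EuclideanSpace ℝ (Fin d))} (hΘ : MeasurableSet Θ)
    {M : EuclideanSpace ℝ (Fin d) → EuclideanSpace ℝ (Fin d)}
    {V : EuclideanSpace ℝ (Fin d) → Matrix (Fin d) (Fin d) ℝ}
    {prior : EuclideanSpace ℝ (Fin d) → ℝ} (hM : AEMeasurable M (volume.restrict Θ))
    (hV : ∀ i j, AEMeasurable (fun θ => V θ i j) (volume.restrict Θ))
    (hprior : ContinuousOn prior Θ) :
    AEMeasurable (kernel n M V prior) (volume.restrict Θ) := by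
  have hV' : AEMeasurable (fun θ i j => V θ i j : _ → Fin d → Fin d → ℝ) (volume.restrict Θ) :=
    aemeasurable_pi_iff.2 fun i => aemeasurable_pi_iff.2 fun j => hV i j
  have hdet : AEMeasurable (fun θ => (V θ).det) (volume.restrict Θ) := by
    have hc : Continuous fun A : Fin d → Fin d → ℝ => (Matrix.of A).det :=
      Continuous.matrix_det continuous_id
    exact hc.measurable.comp_aemeasurable hV'
  -- The inverse is `det⁻¹` times the adjugate, which is polynomial in the entries, so singular
  -- weights cause no trouble.
  have hq : AEMeasurable (fun θ => quad (V θ)⁻¹ (M θ)) (volume.restrict Θ) := by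
    have hc : Continuous fun z : (Fin d → Fin d → ℝ) × EuclideanSpace ℝ (Fin d) =>
        quad (Matrix.of z.1).adjugate z.2 :=
      continuous_quad.comp
        ((Continuous.matrix_adjugate (A := fun z : (Fin d → Fin d → ℝ) ×
          EuclideanSpace ℝ (Fin d) => Matrix.of z.1) continuous_fst).prodMk continuous_snd)
    have h1 := hc.measurable.comp_aemeasurable (hV'.prodMk hM)
    refine (hdet.inv.mul h1).congr (ae_of_all _ fun θ => ?_)
    simp [quad, Matrix.inv_def, Matrix.smul_mulVec]
    exact Or.inl rfl
  exact ((hdet.pow_const _).mul (((hq.div_const 2).const_mul _).neg.exp)).mul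
    (hprior.aemeasurable hΘ)

theorem kernel_eq_sqrt_smul (n : ℕ) (M : EuclideanSpace ℝ (Fin d) → EuclideanSpace ℝ (Fin d))
    (V : EuclideanSpace ℝ (Fin d) → Matrix (Fin d) (Fin d) ℝ)
    (prior : EuclideanSpace ℝ (Fin d) → ℝ) (θ : EuclideanSpace ℝ (Fin d)) :
    kernel n M V prior θ = (V θ).det ^ (-(1 / 2) : ℝ) *
      Real.exp (-(quad (V θ)⁻¹ (Real.sqrt n • M θ) / 2)) * prior θ := by
  rw [kernel, quad_smul, Real.sq_sqrt (Nat.cast_nonneg n), mul_div_assoc]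

end Integrals

/-- The conditions of the theorem along one sequence of outcomes: `N k` is the sample size,
`M k`, `V k` and `τ k` are the realised scores, weights and centring points. -/
structure RegularPath {d : ℕ} (Θ : Set (EuclideanSpace ℝ (Fin d))) (N : ℕ → ℕ)
    (M : ℕ → EuclideanSpace ℝ (Fin d) → EuclideanSpace ℝ (Fin d))
    (V : ℕ → EuclideanSpace ℝ (Fin d) → Matrix (Fin d) (Fin d) ℝ)
    (τ : ℕ → EuclideanSpace ℝ (Fin d))
    (m : EuclideanSpace ℝ (Fin d) → EuclideanSpace ℝ (Fin d))
    (W : EuclideanSpace ℝ (Fin d) → Matrix (Fin d) (Fin d) ℝ)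
    (prior : EuclideanSpace ℝ (Fin d) → ℝ) (p : ℝ) (θs : EuclideanSpace ℝ (Fin d)) : Prop where
  measurableSet : MeasurableSet Θ
  aemeasurable_score : ∀ k, AEMeasurable (M k) (volume.restrict Θ)
  aemeasurable_weight : ∀ k i j, AEMeasurable (fun θ => V k θ i j) (volume.restrict Θ)
  tendsto_size : Tendsto N atTop atTop
  mem_interior : θs ∈ interior Θ
  root : m θs = 0
  strict : HasStrictFDerivAt m (fderiv ℝ m θs) θs
  invertible : IsUnit (negJacobian m θs)
  weight_continuousAt : ContinuousAt W θs
  weight_posDef : (W θs).PosDef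
  weight_posSemidef : ∀ θ ∈ Θ, (W θ).PosSemidef
  identified : ∀ ε : ℝ, 0 < ε → ∃ η : ℝ, 0 < η ∧ ∃ c > 0, ∀ θ ∈ Θ, ε ≤ ‖θ - θs‖ →
    c ≤ quad (W θ + η • (1 : Matrix (Fin d) (Fin d) ℝ))⁻¹ (m θ)
  prior_nonneg : ∀ θ ∈ Θ, 0 ≤ prior θ
  prior_continuousOn : ContinuousOn prior Θ
  prior_pos : 0 < prior θs
  one_le : 1 ≤ p
  center_mem : ∀ k, τ k ∈ Θ
  ulln : ∀ ε : ℝ, 0 < ε → ∀ᶠ k in atTop, ∀ θ ∈ Θ, ‖M k θ - m θ‖ ≤ ε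
  posSemidef : ∀ᶠ k in atTop, ∀ θ ∈ Θ, (V k θ).PosSemidef
  consistent : ∀ ε : ℝ, 0 < ε → ∀ᶠ k in atTop, ∀ θ ∈ Θ, ‖V k θ - W θ‖ ≤ ε
  equicont : ∀ ε : ℝ, 0 < ε → ∃ δ > 0, ∀ᶠ k in atTop, ∀ θ ∈ Θ ∩ Metric.ball θs δ,
    Real.sqrt (N k) * ‖(M k θ - M k θs) - (m θ - m θs)‖ ≤ ε * (1 + Real.sqrt (N k) * ‖θ - θs‖)
  moment : ∃ C : ℝ, ∀ᶠ k in atTop, ∫⁻ θ in Θ, ENNReal.ofReal (V k θ).det ^ (-(1 / 2) : ℝ) *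
    ENNReal.ofReal (‖θ - θs‖ ^ p * prior θ) ≤ ENNReal.ofReal C
  approx_root : ∀ ε : ℝ, 0 < ε → ∀ᶠ k in atTop, ‖Real.sqrt (N k) • M k (τ k)‖ ≤ ε
  tight : ∃ K : ℝ, ∀ᶠ k in atTop, ‖Real.sqrt (N k) • M k θs‖ ≤ K

/-- The indicator of `Θ` times the unnormalised Q-posterior density, in the local parameter. -/
def localKernel {d : ℕ} (n : ℕ) (Θ : Set (EuclideanSpace ℝ (Fin d)))
    (M : EuclideanSpace ℝ (Fin d) → EuclideanSpace ℝ (Fin d))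
    (V : EuclideanSpace ℝ (Fin d) → Matrix (Fin d) (Fin d) ℝ)
    (prior : EuclideanSpace ℝ (Fin d) → ℝ) (τ t : EuclideanSpace ℝ (Fin d)) : ℝ :=
  Θ.indicator (kernel n M V prior) (τ + (Real.sqrt n)⁻¹ • t)

/-! ### Jacobian and precision matrix of the limit -/

section Deterministic

variable {d : ℕ}

/-- Only an inequality, because the norm is `0` when `d = 0`. -/
theorem norm_one_matrix_le : ‖(1 : Matrix (Fin d) (Fin d) ℝ)‖ ≤ 1 := by
  rw [Matrix.l2_opNorm_def]
  refine ContinuousLinearMap.opNorm_le_bound _ zero_le_one fun x => ?_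
  have : (Matrix.toEuclideanCLM (𝕜 := ℝ) (1 : Matrix (Fin d) (Fin d) ℝ)) x = x := by
    rw [map_one]; rfl
  exact (congrArg norm this).le.trans_eq (one_mul _).symm

theorem fderiv_apply_eq (m : EuclideanSpace ℝ (Fin d) → EuclideanSpace ℝ (Fin d))
    (θ x : EuclideanSpace ℝ (Fin d)) :
    fderiv ℝ m θ x = -WithLp.toLp 2 (negJacobian m θ *ᵥ x.ofLp) := by
  have hx : x = ∑ j, x j • EuclideanSpace.single j (1 : ℝ) := by
    ext i
    simp [Finset.sum_apply, Pi.single_apply]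
  ext i
  conv_lhs => rw [hx]
  simp [Matrix.mulVec, dotProduct, negJacobian, map_sum, mul_comm]

theorem quad_inv_fderiv (m : EuclideanSpace ℝ (Fin d) → EuclideanSpace ℝ (Fin d))
    (W : EuclideanSpace ℝ (Fin d) → Matrix (Fin d) (Fin d) ℝ)
    (θ x : EuclideanSpace ℝ (Fin d)) :
    quad (W θ)⁻¹ (fderiv ℝ m θ x) = quad (precision m W θ) x := by
  rw [fderiv_apply_eq, quad_neg, precision, quad_transpose_mul_mul]

theorem posDef_precision {m : EuclideanSpace ℝ (Fin d) → EuclideanSpace ℝ (Fin d)}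
    {W : EuclideanSpace ℝ (Fin d) → Matrix (Fin d) (Fin d) ℝ} {θ : EuclideanSpace ℝ (Fin d)}
    (hH : IsUnit (negJacobian m θ)) (hW : (W θ).PosDef) : (precision m W θ).PosDef := by
  have := (Matrix.IsUnit.posDef_star_left_conjugate_iff (x := (W θ)⁻¹) hH).2 hW.inv
  simpa [precision, Matrix.star_eq_conjTranspose,
    Matrix.conjTranspose_eq_transpose_of_trivial] using this

end Deterministic

/-! ### Consistency of the centring points and local linear expansion -/

namespace RegularPath

variable {d : ℕ} {Θ : Set (EuclideanSpace ℝ (Fin d))} {N : ℕ → ℕ}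
  {M : ℕ → EuclideanSpace ℝ (Fin d) → EuclideanSpace ℝ (Fin d)}
  {V : ℕ → EuclideanSpace ℝ (Fin d) → Matrix (Fin d) (Fin d) ℝ}
  {τ : ℕ → EuclideanSpace ℝ (Fin d)}
  {m : EuclideanSpace ℝ (Fin d) → EuclideanSpace ℝ (Fin d)}
  {W : EuclideanSpace ℝ (Fin d) → Matrix (Fin d) (Fin d) ℝ}
  {prior : EuclideanSpace ℝ (Fin d) → ℝ} {p : ℝ} {θs : EuclideanSpace ℝ (Fin d)}

theorem mem_nhds (h : RegularPath Θ N M V τ m W prior p θs) : Θ ∈ 𝓝 θs :=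
  mem_interior_iff_mem_nhds.1 h.mem_interior

theorem one_le_size (h : RegularPath Θ N M V τ m W prior p θs) : ∀ᶠ k in atTop, 1 ≤ N k :=
  h.tendsto_size.eventually_ge_atTop 1

theorem tendsto_sqrt_size (h : RegularPath Θ N M V τ m W prior p θs) :
    Tendsto (fun k => Real.sqrt (N k)) atTop atTop :=
  Real.tendsto_sqrt_atTop.comp (tendsto_natCast_atTop_atTop.comp h.tendsto_size)

/-- Identification keeps `m` away from `0` outside a ball around `θs`, whereas the uniform law makes
`m (τ k)` small. -/
theorem tendsto_center (h : RegularPath Θ N M V τ m W prior p θs) :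
    Tendsto τ atTop (𝓝 θs) := by
  rw [Metric.tendsto_nhds]
  intro ε hε
  obtain ⟨η, hη, c, hc, hid⟩ := h.identified ε hε
  set e := Real.sqrt (η * c) / 8 with he
  have hηc : 0 < η * c := by positivity
  have he0 : 0 < e := by positivity
  filter_upwards [h.ulln e he0, h.approx_root e he0, h.one_le_size] with k h1 h2 h3
  by_contra hcon
  rw [dist_eq_norm, not_lt] at hcon
  have h4 := hid _ (h.center_mem k) hcon
  have hs : 1 ≤ Real.sqrt (N k) := Real.one_le_sqrt.2 (by exact_mod_cast h3)
  have h5 : ‖M k (τ k)‖ ≤ e := by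
    rw [norm_smul, Real.norm_of_nonneg (Real.sqrt_nonneg _)] at h2
    nlinarith [norm_nonneg (M k (τ k))]
  have h6 : ‖m (τ k)‖ ≤ 2 * e := by
    have := norm_sub_le (M k (τ k)) (M k (τ k) - m (τ k))
    rw [sub_sub_cancel] at this
    linarith [h1 _ (h.center_mem k)]
  have hWp := h.weight_posSemidef _ (h.center_mem k)
  -- With `x = 0` the lower bound becomes an upper bound on the regularised form of `m (τ k)`.
  have h7 := half_quad_regularised_sub_le (V := W (τ k) + η • (1 : Matrix (Fin d) (Fin d) ℝ))
    (W := W (τ k)) hη (Matrix.PosDef.posSemidef_add hWp (Matrix.PosDef.one.smul hη)) hWp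
    (by
      rw [add_sub_cancel_left, norm_smul, Real.norm_of_nonneg hη.le]
      exact mul_le_of_le_one_right hη.le norm_one_matrix_le)
    (x := 0) (m := m (τ k)) (e := 2 * e) (by simpa using h6)
  have h8 : quad (W (τ k) + η • (1 : Matrix (Fin d) (Fin d) ℝ))⁻¹ 0 = 0 := by simp [quad]
  have h9 : 2 * (2 * e) ^ 2 / η = c / 8 := by
    rw [he]
    rw [show 2 * (2 * (Real.sqrt (η * c) / 8)) ^ 2 = Real.sqrt (η * c) ^ 2 / 8 by ring,
      Real.sq_sqrt hηc.le]
    field_simp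
  linarith

/-- The filter `atTop ×ˢ 𝓝 θs` encodes uniformity near `θs`; it serves both moving points (pointwise
limits) and a fixed ball (domination). -/
theorem tendsto_weight (h : RegularPath Θ N M V τ m W prior p θs) :
    Tendsto (fun q : ℕ × EuclideanSpace ℝ (Fin d) => V q.1 q.2) (atTop ×ˢ 𝓝 θs)
      (𝓝 (W θs)) := by
  rw [Metric.tendsto_nhds]
  intro ε hε
  have h1 : ∀ᶠ q : ℕ × EuclideanSpace ℝ (Fin d) in atTop ×ˢ 𝓝 θs,
      ∀ θ ∈ Θ, ‖V q.1 θ - W θ‖ ≤ ε / 2 := tendsto_fst.eventually (h.consistent _ (half_pos hε))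
  have h2 : ∀ᶠ q : ℕ × EuclideanSpace ℝ (Fin d) in atTop ×ˢ 𝓝 θs, q.2 ∈ Θ :=
    tendsto_snd.eventually h.mem_nhds
  have h3 : ∀ᶠ q : ℕ × EuclideanSpace ℝ (Fin d) in atTop ×ˢ 𝓝 θs,
      dist (W q.2) (W θs) < ε / 2 :=
    tendsto_snd.eventually (Metric.tendsto_nhds.1 h.weight_continuousAt _ (half_pos hε))
  filter_upwards [h1, h2, h3] with q h1 h2 h3
  have := dist_triangle (V q.1 q.2) (W q.2) (W θs)
  rw [dist_eq_norm (V q.1 q.2) (W q.2)] at this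
  linarith [h1 _ h2]

theorem eventually_remainder_le (h : RegularPath Θ N M V τ m W prior p θs) {ε : ℝ} (hε : 0 < ε) :
    ∀ᶠ q : ℕ × EuclideanSpace ℝ (Fin d) in atTop ×ˢ 𝓝 θs,
      Real.sqrt (N q.1) * ‖(M q.1 q.2 - M q.1 θs) - m q.2‖ ≤
        ε * (1 + Real.sqrt (N q.1) * ‖q.2 - θs‖) := by
  obtain ⟨δ, hδ, hk⟩ := h.equicont ε hε
  have h2 : ∀ᶠ q : ℕ × EuclideanSpace ℝ (Fin d) in atTop ×ˢ 𝓝 θs, q.2 ∈ Θ ∩ Metric.ball θs δ :=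
    tendsto_snd.eventually (inter_mem h.mem_nhds (Metric.ball_mem_nhds _ hδ))
  filter_upwards [tendsto_fst.eventually hk, h2] with q h1 h2
  simpa [h.root] using h1 _ h2

theorem tendsto_prodMk_center (h : RegularPath Θ N M V τ m W prior p θs) :
    Tendsto (fun k => (k, τ k)) atTop (atTop ×ˢ 𝓝 θs) :=
  tendsto_id.prodMk h.tendsto_center

/-- Root-`n` consistency. The invertible Jacobian bounds `l ‖τ k - θs‖` by `‖m (τ k)‖` up to
linearisation error, and the scaled scores at `τ k` and `θs` are bounded. Linearisation and
equicontinuity each cost `l / 4`, leaving `l / 2`. -/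
theorem exists_sqrt_mul_norm_center_sub_le (h : RegularPath Θ N M V τ m W prior p θs) :
    ∃ B : ℝ, 0 ≤ B ∧ ∀ᶠ k in atTop, Real.sqrt (N k) * ‖τ k - θs‖ ≤ B := by
  obtain ⟨l, hl, hL⟩ := exists_norm_le_norm_mulVec h.invertible
  obtain ⟨K, hK⟩ := h.tight
  have hlin : ∀ᶠ θ in 𝓝 θs, ‖m θ - m θs - fderiv ℝ m θs (θ - θs)‖ ≤ l / 4 * ‖θ - θs‖ :=
    h.strict.hasFDerivAt.isLittleO.def (by positivity)
  refine ⟨max ((1 + K + l / 4) / (l / 2)) 0, le_max_right _ _, ?_⟩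
  filter_upwards [hK, h.approx_root 1 one_pos, h.tendsto_center.eventually hlin,
    h.tendsto_prodMk_center.eventually (h.eventually_remainder_le (ε := l / 4) (by positivity))]
    with k h1 h2 h3 h4
  refine le_max_of_le_left ?_
  rw [le_div_iff₀ (by positivity)]
  set s := Real.sqrt (N k)
  have hs : 0 ≤ s := Real.sqrt_nonneg _
  have h5 : l * ‖τ k - θs‖ ≤ ‖fderiv ℝ m θs (τ k - θs)‖ := by
    rw [fderiv_apply_eq, norm_neg]; exact hL _
  rw [h.root, sub_zero] at h3
  have h6 : ‖fderiv ℝ m θs (τ k - θs)‖ ≤ ‖m (τ k)‖ + l / 4 * ‖τ k - θs‖ := by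
    have := norm_sub_le (m (τ k)) (m (τ k) - fderiv ℝ m θs (τ k - θs))
    rw [sub_sub_cancel] at this
    linarith
  have h7 : s * ‖m (τ k)‖ ≤ 1 + K + l / 4 * (1 + s * ‖τ k - θs‖) := by
    have e1 : s • m (τ k) = s • M k (τ k) - s • M k θs -
        s • ((M k (τ k) - M k θs) - m (τ k)) := by module
    calc s * ‖m (τ k)‖ = ‖s • m (τ k)‖ := by rw [norm_smul, Real.norm_of_nonneg hs]
      _ ≤ ‖s • M k (τ k)‖ + ‖s • M k θs‖ + ‖s • ((M k (τ k) - M k θs) - m (τ k))‖ := by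
        rw [e1]
        exact (norm_sub_le _ _).trans (add_le_add_left (norm_sub_le _ _) _)
      _ ≤ _ := by
        rw [norm_smul s (_ - _), Real.norm_of_nonneg hs]
        linarith
  nlinarith [mul_le_mul_of_nonneg_left (h5.trans h6) hs]

/-- Local linear expansion of the scaled scores around the centring points. -/
theorem eventually_norm_sqrt_smul_sub_le (h : RegularPath Θ N M V τ m W prior p θs) {ε : ℝ}
    (hε : 0 < ε) : ∀ᶠ q : ℕ × EuclideanSpace ℝ (Fin d) in atTop ×ˢ 𝓝 θs,
      ‖Real.sqrt (N q.1) • M q.1 q.2 - fderiv ℝ m θs (Real.sqrt (N q.1) • (q.2 - τ q.1))‖ ≤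
        ε * (1 + ‖Real.sqrt (N q.1) • (q.2 - τ q.1)‖) := by
  obtain ⟨B, hB0, hB⟩ := h.exists_sqrt_mul_norm_center_sub_le
  -- With `x = ‖√N (θ - τ)‖`, the errors below add up to at most `e (3 + 2B + 2x) ≤ 4 e (1 + B) (1 +
  -- x)`.
  set e := ε / (4 * (1 + B)) with he
  have he0 : 0 < e := by positivity
  -- Both `θ` and `τ k` move, hence strict differentiability.
  have hlin : ∀ᶠ z : EuclideanSpace ℝ (Fin d) × EuclideanSpace ℝ (Fin d) in 𝓝 θs ×ˢ 𝓝 θs,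
      ‖m z.1 - m z.2 - fderiv ℝ m θs (z.1 - z.2)‖ ≤ e * ‖z.1 - z.2‖ := by
    rw [← nhds_prod_eq]
    exact h.strict.isLittleO.def he0
  have hpair : Tendsto (fun q : ℕ × EuclideanSpace ℝ (Fin d) => (q.2, τ q.1)) (atTop ×ˢ 𝓝 θs)
      (𝓝 θs ×ˢ 𝓝 θs) := tendsto_snd.prodMk (h.tendsto_center.comp tendsto_fst)
  filter_upwards [hpair.eventually hlin, tendsto_fst.eventually hB,
    tendsto_fst.eventually (h.approx_root e he0),
    tendsto_fst.eventually (h.tendsto_prodMk_center.eventually (h.eventually_remainder_le he0)),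
    h.eventually_remainder_le he0] with q h1 h2 h3 h4 h5
  obtain ⟨k, θ⟩ := q
  dsimp only at h1 h2 h3 h4 h5 ⊢
  set s := Real.sqrt (N k)
  have hs : 0 ≤ s := Real.sqrt_nonneg _
  have e1 : s • M k θ - fderiv ℝ m θs (s • (θ - τ k)) = s • M k (τ k) +
      s • (m θ - m (τ k) - fderiv ℝ m θs (θ - τ k)) + s • ((M k θ - M k θs) - m θ) -
      s • ((M k (τ k) - M k θs) - m (τ k)) := by
    rw [map_smul]; module
  have ht : ‖s • (θ - τ k)‖ = s * ‖θ - τ k‖ := by rw [norm_smul, Real.norm_of_nonneg hs]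
  have h6 : s * ‖θ - θs‖ ≤ s * ‖θ - τ k‖ + B := by
    have := mul_le_mul_of_nonneg_left (norm_sub_le_norm_sub_add_norm_sub θ (τ k) θs) hs
    linarith
  have h7 : ‖s • M k θ - fderiv ℝ m θs (s • (θ - τ k))‖ ≤ e + e * (s * ‖θ - τ k‖) +
      e * (1 + s * ‖θ - θs‖) + e * (1 + s * ‖τ k - θs‖) := by
    rw [e1]
    refine (norm_sub_le _ _).trans (add_le_add (norm_add₃_le.trans
      (add_le_add (add_le_add h3 ?_) ?_)) ?_)
    all_goals rw [norm_smul, Real.norm_of_nonneg hs]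
    · nlinarith [mul_le_mul_of_nonneg_left h1 hs]
    · exact h5
    · exact h4
  rw [ht]
  have h8 : e * (4 * (1 + B)) = ε := by rw [he]; field_simp
  have hx : 0 ≤ s * ‖θ - τ k‖ := by positivity
  nlinarith [mul_nonneg he0.le hx, mul_nonneg he0.le hB0, mul_nonneg (mul_nonneg he0.le hB0) hx,
    mul_le_mul_of_nonneg_left h6 he0.le, mul_le_mul_of_nonneg_left h2 he0.le]

end RegularPath

/-! ### Limit, domination and tails of the kernel -/

namespace RegularPath

variable {d : ℕ} {Θ : Set (EuclideanSpace ℝ (Fin d))} {N : ℕ → ℕ}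
  {M : ℕ → EuclideanSpace ℝ (Fin d) → EuclideanSpace ℝ (Fin d)}
  {V : ℕ → EuclideanSpace ℝ (Fin d) → Matrix (Fin d) (Fin d) ℝ}
  {τ : ℕ → EuclideanSpace ℝ (Fin d)}
  {m : EuclideanSpace ℝ (Fin d) → EuclideanSpace ℝ (Fin d)}
  {W : EuclideanSpace ℝ (Fin d) → Matrix (Fin d) (Fin d) ℝ}
  {prior : EuclideanSpace ℝ (Fin d) → ℝ} {p : ℝ} {θs : EuclideanSpace ℝ (Fin d)}

theorem tendsto_weight_inv (h : RegularPath Θ N M V τ m W prior p θs) :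
    Tendsto (fun q : ℕ × EuclideanSpace ℝ (Fin d) => (V q.1 q.2)⁻¹) (atTop ×ˢ 𝓝 θs)
      (𝓝 (W θs)⁻¹) :=
  (continuousAt_matrix_inv h.weight_posDef.isUnit).tendsto.comp h.tendsto_weight

theorem tendsto_det_rpow (h : RegularPath Θ N M V τ m W prior p θs) :
    Tendsto (fun q : ℕ × EuclideanSpace ℝ (Fin d) => (V q.1 q.2).det ^ (-(1 / 2) : ℝ))
      (atTop ×ˢ 𝓝 θs) (𝓝 ((W θs).det ^ (-(1 / 2) : ℝ))) := by
  have hc : Continuous fun A : Matrix (Fin d) (Fin d) ℝ => A.det :=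
    Continuous.matrix_det continuous_id
  exact ((hc.tendsto _).comp h.tendsto_weight).rpow_const (Or.inl h.weight_posDef.det_pos.ne')

theorem tendsto_prior (h : RegularPath Θ N M V τ m W prior p θs) :
    Tendsto (fun q : ℕ × EuclideanSpace ℝ (Fin d) => prior q.2) (atTop ×ˢ 𝓝 θs)
      (𝓝 (prior θs)) :=
  (h.prior_continuousOn.continuousAt h.mem_nhds).tendsto.comp tendsto_snd

theorem tendsto_add_inv_sqrt_smul (h : RegularPath Θ N M V τ m W prior p θs)
    (t : EuclideanSpace ℝ (Fin d)) :
    Tendsto (fun k => τ k + (Real.sqrt (N k))⁻¹ • t) atTop (𝓝 θs) := by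
  have := h.tendsto_center.add
    ((tendsto_inv_atTop_zero.comp h.tendsto_sqrt_size).smul_const t)
  simpa using this

theorem sqrt_size_pos (h : RegularPath Θ N M V τ m W prior p θs) :
    ∀ᶠ k in atTop, 0 < Real.sqrt (N k) :=
  h.tendsto_sqrt_size.eventually_gt_atTop 0

theorem tendsto_kernel (h : RegularPath Θ N M V τ m W prior p θs)
    (t : EuclideanSpace ℝ (Fin d)) :
    Tendsto (fun k => kernel (N k) (M k) (V k) prior (τ k + (Real.sqrt (N k))⁻¹ • t)) atTop
      (𝓝 ((W θs).det ^ (-(1 / 2) : ℝ) * Real.exp (-(quad (precision m W θs) t / 2)) *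
        prior θs)) := by
  have hpair : Tendsto (fun k => (k, τ k + (Real.sqrt (N k))⁻¹ • t)) atTop (atTop ×ˢ 𝓝 θs) :=
    tendsto_id.prodMk (h.tendsto_add_inv_sqrt_smul t)
  have hM : Tendsto (fun k => Real.sqrt (N k) • M k (τ k + (Real.sqrt (N k))⁻¹ • t)) atTop
      (𝓝 (fderiv ℝ m θs t)) := by
    rw [Metric.tendsto_nhds]
    intro ε hε
    have hε' : 0 < ε / 2 / (1 + ‖t‖) := by positivity
    filter_upwards [hpair.eventually (h.eventually_norm_sqrt_smul_sub_le hε'), h.sqrt_size_pos]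
      with k h1 h2
    rw [add_sub_cancel_left, smul_inv_smul₀ h2.ne'] at h1
    rw [dist_eq_norm]
    refine h1.trans_lt ?_
    rw [div_mul_cancel₀ _ (by positivity)]
    linarith
  simp_rw [kernel_eq_sqrt_smul]
  rw [← quad_inv_fderiv]
  have hq := (continuous_quad.tendsto ((W θs)⁻¹, fderiv ℝ m θs t)).comp
    ((h.tendsto_weight_inv.comp hpair).prodMk_nhds hM)
  exact ((h.tendsto_det_rpow.comp hpair).mul ((hq.div_const 2).neg.rexp)).mul
    (h.tendsto_prior.comp hpair)

/-- Gaussian domination of the kernel near `θs`. -/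
theorem exists_abs_kernel_le (h : RegularPath Θ N M V τ m W prior p θs) :
    ∃ D b : ℝ, 0 < b ∧ ∀ᶠ q : ℕ × EuclideanSpace ℝ (Fin d) in atTop ×ˢ 𝓝 θs,
      |kernel (N q.1) (M q.1) (V q.1) prior q.2| ≤
        D * Real.exp (-b * ‖Real.sqrt (N q.1) • (q.2 - τ q.1)‖ ^ 2) := by
  obtain ⟨a, ha, hA⟩ := exists_mul_norm_sq_le_quad h.weight_posDef.inv
  obtain ⟨l, hl, hL⟩ := exists_norm_le_norm_mulVec h.invertible
  set D₁ := |(W θs).det ^ (-(1 / 2) : ℝ)| + 1 with hD₁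
  set D₂ := |prior θs| + 1 with hD₂
  refine ⟨D₁ * Real.exp (a * l ^ 2 / 16) * D₂, a * l ^ 2 / 32, by positivity, ?_⟩
  have hdet := h.tendsto_det_rpow.abs.eventually_le_const (lt_add_one _)
  have hpri := h.tendsto_prior.abs.eventually_le_const (lt_add_one _)
  have hinv := (tendsto_iff_norm_sub_tendsto_zero.1 h.tendsto_weight_inv).eventually_le_const
    (half_pos ha)
  filter_upwards [hdet, hpri, hinv, h.eventually_norm_sqrt_smul_sub_le (half_pos hl)]
    with q h1 h2 h3 h4
  set t := Real.sqrt (N q.1) • (q.2 - τ q.1)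
  set x := Real.sqrt (N q.1) • M q.1 q.2
  have hLt : l * ‖t‖ ≤ ‖fderiv ℝ m θs t‖ := by
    rw [fderiv_apply_eq, norm_neg]; exact hL _
  -- The expansion error `l / 2 * (1 + ‖t‖)` uses up half of the linear lower bound `l * ‖t‖`.
  have hx : l / 2 * (‖t‖ - 1) ≤ ‖x‖ := by
    have := norm_sub_le x (x - fderiv ℝ m θs t)
    rw [sub_sub_cancel] at this
    linarith
  -- For `‖t‖ < 1` the bound `hx` has a negative left side and cannot be squared, but then the left
  -- side here is nonpositive.
  have hx2 : l ^ 2 / 4 * (‖t‖ ^ 2 / 2 - 1) ≤ ‖x‖ ^ 2 := by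
    have key : ‖t‖ ^ 2 / 2 - 1 ≤ (‖t‖ - 1) ^ 2 := by nlinarith [sq_nonneg (‖t‖ - 2)]
    rcases le_total 1 ‖t‖ with ht | ht
    · have := pow_le_pow_left₀ (by have := sub_nonneg.2 ht; positivity) hx 2
      nlinarith [mul_le_mul_of_nonneg_left key (show 0 ≤ l ^ 2 / 4 by positivity)]
    · have : ‖t‖ ^ 2 / 2 - 1 ≤ 0 := by nlinarith [norm_nonneg t]
      nlinarith [mul_nonneg (show 0 ≤ l ^ 2 / 4 by positivity) (neg_nonneg.2 this),
        sq_nonneg ‖x‖]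
  have hquad : a / 2 * ‖x‖ ^ 2 ≤ quad (V q.1 q.2)⁻¹ x := by
    have e1 := (abs_le.1 (abs_quad_le ((V q.1 q.2)⁻¹ - (W θs)⁻¹) x)).1
    rw [quad_sub_left] at e1
    nlinarith [hA x, mul_le_mul_of_nonneg_right h3 (sq_nonneg ‖x‖)]
  rw [kernel_eq_sqrt_smul, abs_mul, abs_mul, Real.abs_exp]
  have hexp : Real.exp (-(quad (V q.1 q.2)⁻¹ x / 2)) ≤
      Real.exp (a * l ^ 2 / 16) * Real.exp (-(a * l ^ 2 / 32) * ‖t‖ ^ 2) := by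
    rw [← Real.exp_add]
    apply Real.exp_le_exp.2
    nlinarith [mul_le_mul_of_nonneg_left hx2 ha.le]
  calc _ ≤ D₁ * (Real.exp (a * l ^ 2 / 16) * Real.exp (-(a * l ^ 2 / 32) * ‖t‖ ^ 2)) * D₂ := by
        gcongr
    _ = _ := by ring

/-- Exponential bound for the kernel away from `θs`. -/
theorem exists_ofReal_mul_abs_kernel_le (h : RegularPath Θ N M V τ m W prior p θs) {δ : ℝ}
    (hδ : 0 < δ) : ∃ C b : ℝ, 0 < b ∧ ∀ᶠ k in atTop, ∀ θ ∈ Θ, δ ≤ ‖θ - θs‖ →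
      ENNReal.ofReal ((1 + ‖Real.sqrt (N k) • (θ - τ k)‖) * |kernel (N k) (M k) (V k) prior θ|) ≤
        ENNReal.ofReal (C * Real.sqrt (N k) * Real.exp (-b * N k)) *
          (ENNReal.ofReal (V k θ).det ^ (-(1 / 2) : ℝ) *
            ENNReal.ofReal (‖θ - θs‖ ^ p * prior θ)) := by
  obtain ⟨η, hη, c, hc, hid⟩ := h.identified δ hδ
  have hec : 0 < η * c / 8 := by positivity
  -- With `r = ‖θ - θs‖ ≥ δ` and `p ≥ 1`, the weight is at most `√N (2 + r) ≤ √N (2 + δ) (r / δ) ^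
  -- p`. The rate is half of the bound `c / 4` on the form.
  refine ⟨(2 + δ) / δ ^ p, c / 8, by positivity, ?_⟩
  filter_upwards [h.ulln _ (Real.sqrt_pos.2 hec), h.consistent η hη, h.posSemidef,
    Metric.tendsto_nhds.1 h.tendsto_center 1 one_pos, h.one_le_size]
    with k h1 h2 h3 h4 h5 θ hθ hδθ
  have hs : 1 ≤ Real.sqrt (N k) := Real.one_le_sqrt.2 (by exact_mod_cast h5)
  have hpri := h.prior_nonneg θ hθ
  -- For real powers `0 ^ (-1/2) = 0`, so `kernel` vanishes at singular weights.
  rcases (h3 θ hθ).det_nonneg.eq_or_lt with hd | hd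
  · have : kernel (N k) (M k) (V k) prior θ = 0 := by
      rw [kernel, ← hd, Real.zero_rpow (by norm_num)]; ring
    simp [this]
  have hV : (V k θ).PosDef := (h3 θ hθ).posDef_iff_isUnit.2
    ((Matrix.isUnit_iff_isUnit_det _).2 hd.ne'.isUnit)
  have hq : c / 4 ≤ quad (V k θ)⁻¹ (M k θ) := by
    have e1 := half_quad_regularised_sub_le hη hV (h.weight_posSemidef θ hθ) (h2 θ hθ) (h1 θ hθ)
    rw [Real.sq_sqrt hec.le] at e1
    have e2 : 2 * (η * c / 8) / η = c / 4 := by field_simp; norm_num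
    linarith [hid θ hθ hδθ]
  set r := ‖θ - θs‖
  have hr : 0 < r := hδ.trans_le hδθ
  have hτ : ‖θ - τ k‖ ≤ r + 1 := by
    have e1 := norm_sub_le_norm_sub_add_norm_sub θ θs (τ k)
    rw [dist_eq_norm, norm_sub_rev] at h4
    linarith
  have hrp : 2 + r ≤ (2 + δ) / δ ^ p * r ^ p := by
    have e1 : 1 ≤ r / δ := (one_le_div hδ).2 hδθ
    have e2 : r / δ ≤ (r / δ) ^ p := by
      simpa using Real.rpow_le_rpow_of_exponent_le e1 h.one_le
    rw [Real.div_rpow hr.le hδ.le] at e2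
    have e3 : r ≤ δ * (r ^ p / δ ^ p) := by
      rw [div_le_iff₀ hδ] at e2; linarith
    calc 2 + r ≤ 2 * (r ^ p / δ ^ p) + δ * (r ^ p / δ ^ p) := by linarith
      _ = _ := by ring
  have hnorm : 1 + ‖Real.sqrt (N k) • (θ - τ k)‖ ≤
      Real.sqrt (N k) * ((2 + δ) / δ ^ p * r ^ p) := by
    rw [norm_smul, Real.norm_of_nonneg (Real.sqrt_nonneg _)]
    nlinarith
  rw [ENNReal.ofReal_rpow_of_pos hd, ← ENNReal.ofReal_mul (by positivity),
    ← ENNReal.ofReal_mul (by positivity)]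
  apply ENNReal.ofReal_le_ofReal
  have hk : |kernel (N k) (M k) (V k) prior θ| ≤
      (V k θ).det ^ (-(1 / 2) : ℝ) * Real.exp (-(c / 8) * N k) * prior θ := by
    rw [abs_of_nonneg (by unfold kernel; positivity), kernel]
    gcongr
    nlinarith [mul_le_mul_of_nonneg_left hq (Nat.cast_nonneg (α := ℝ) (N k))]
  calc _ ≤ Real.sqrt (N k) * ((2 + δ) / δ ^ p * r ^ p) *
        ((V k θ).det ^ (-(1 / 2) : ℝ) * Real.exp (-(c / 8) * N k) * prior θ) := by
        gcongr
    _ = _ := by ring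

theorem aemeasurable_localKernel (h : RegularPath Θ N M V τ m W prior p θs)
    {S : Set (EuclideanSpace ℝ (Fin d))} (hS : MeasurableSet S) (hSΘ : S ⊆ Θ) {k : ℕ}
    (hk : 0 < Real.sqrt (N k)) :
    AEMeasurable (localKernel (N k) S (M k) (V k) prior (τ k)) := by
  refine aemeasurable_comp_add_inv_smul hk (τ k) ((aemeasurable_indicator_iff hS).2 ?_)
  exact (aemeasurable_kernel h.measurableSet (h.aemeasurable_score k) (h.aemeasurable_weight k)
    h.prior_continuousOn).mono_measure (Measure.restrict_mono hSΘ le_rfl)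

theorem tendsto_lintegral_far (h : RegularPath Θ N M V τ m W prior p θs) {δ : ℝ} (hδ : 0 < δ) :
    Tendsto (fun k => ∫⁻ t, ENNReal.ofReal ((1 + ‖t‖) *
      |localKernel (N k) (Θ \ Metric.ball θs δ) (M k) (V k) prior (τ k) t|)) atTop (𝓝 0) := by
  obtain ⟨C, b, hb, hfar⟩ := h.exists_ofReal_mul_abs_kernel_le hδ
  obtain ⟨C', hmom⟩ := h.moment
  have hup : ∀ᶠ k in atTop, ∫⁻ t, ENNReal.ofReal ((1 + ‖t‖) *
      |localKernel (N k) (Θ \ Metric.ball θs δ) (M k) (V k) prior (τ k) t|) ≤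
      ENNReal.ofReal (C * ((N k : ℝ) ^ (((d : ℝ) + 1) / 2) * Real.exp (-b * N k))) *
        ENNReal.ofReal C' := by
    filter_upwards [hfar, hmom, h.sqrt_size_pos] with k h1 h2 h3
    set s := Real.sqrt (N k) with hs
    have e1 : ∀ t, ENNReal.ofReal ((1 + ‖t‖) *
        |localKernel (N k) (Θ \ Metric.ball θs δ) (M k) (V k) prior (τ k) t|) =
        (fun θ => ENNReal.ofReal ((1 + ‖s • (θ - τ k)‖) *
          |(Θ \ Metric.ball θs δ).indicator (kernel (N k) (M k) (V k) prior) θ|))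
          (τ k + s⁻¹ • t) := fun t => by
      simp only [add_sub_cancel_left, smul_inv_smul₀ h3.ne', localKernel, ← hs]
    have e2 : ∀ θ, ENNReal.ofReal ((1 + ‖s • (θ - τ k)‖) *
          |(Θ \ Metric.ball θs δ).indicator (kernel (N k) (M k) (V k) prior) θ|) ≤
        Θ.indicator (fun θ => ENNReal.ofReal (C * s * Real.exp (-b * N k)) *
          (ENNReal.ofReal (V k θ).det ^ (-(1 / 2) : ℝ) *
            ENNReal.ofReal (‖θ - θs‖ ^ p * prior θ))) θ := fun θ => by
      by_cases hθ : θ ∈ Θ \ Metric.ball θs δ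
      · rw [Set.indicator_of_mem hθ, Set.indicator_of_mem hθ.1]
        refine h1 θ hθ.1 ?_
        rw [← dist_eq_norm]
        exact not_lt.1 hθ.2
      · simp [Set.indicator_of_notMem hθ]
    rw [lintegral_congr e1, lintegral_comp_add_inv_smul h3 (τ k) (fun θ =>
      ENNReal.ofReal ((1 + ‖s • (θ - τ k)‖) *
        |(Θ \ Metric.ball θs δ).indicator (kernel (N k) (M k) (V k) prior) θ|))]
    refine (mul_le_mul_right (lintegral_mono e2) _).trans ?_
    rw [lintegral_indicator h.measurableSet, lintegral_const_mul' _ _ ENNReal.ofReal_ne_top,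
      ← mul_assoc, ← ENNReal.ofReal_mul (by positivity)]
    refine mul_le_mul' (le_of_eq ?_) h2
    congr 1
    have e3 : (N k : ℝ) ^ (((d : ℝ) + 1) / 2) = s ^ d * s := by
      rw [← pow_succ, hs, Real.sqrt_eq_rpow, ← Real.rpow_natCast, ← Real.rpow_mul (by positivity)]
      congr 1; push_cast; ring
    rw [e3]; ring
  refine tendsto_of_tendsto_of_tendsto_of_le_of_le' tendsto_const_nhds ?_
    (Eventually.of_forall fun _ => zero_le) hup
  -- The power of `N` collects `√N ^ d` from the change of variables and `√N` from the weight `1 +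
  -- ‖t‖`.
  have h4 := (tendsto_rpow_mul_exp_neg_mul_atTop_nhds_zero (((d : ℝ) + 1) / 2) b hb).comp
    (tendsto_natCast_atTop_atTop.comp h.tendsto_size)
  have h5 := ENNReal.Tendsto.mul_const (ENNReal.tendsto_ofReal (h4.const_mul C))
    (Or.inr (ENNReal.ofReal_ne_top (r := C')))
  simpa [Function.comp_def] using h5

/-- Weighted `L¹` convergence of the unnormalised local densities near `θs`. -/
theorem tendsto_lintegral_near (h : RegularPath Θ N M V τ m W prior p θs) :
    ∃ δ > 0, Tendsto (fun k => ∫⁻ t, ENNReal.ofReal ((1 + ‖t‖) *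
      |localKernel (N k) (Θ ∩ Metric.ball θs δ) (M k) (V k) prior (τ k) t -
        (W θs).det ^ (-(1 / 2) : ℝ) * Real.exp (-(quad (precision m W θs) t / 2)) *
        prior θs|)) atTop (𝓝 0) := by
  obtain ⟨D, b, hb, hD⟩ := h.exists_abs_kernel_le
  -- Splitting the product filter yields one radius valid for all large `k`.
  obtain ⟨pa, hpa, pb, hpb, hab⟩ := eventually_prod_iff.1 hD
  obtain ⟨δ, hδ, hball⟩ := Metric.eventually_nhds_iff_ball.1 hpb
  refine ⟨δ, hδ, ?_⟩
  have hpd := posDef_precision h.invertible h.weight_posDef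
  set f : EuclideanSpace ℝ (Fin d) → ℝ := fun t =>
    (W θs).det ^ (-(1 / 2) : ℝ) * Real.exp (-(quad (precision m W θs) t / 2)) * prior θs with hf
  have hqc : Continuous fun x : EuclideanSpace ℝ (Fin d) => quad (precision m W θs) x :=
    continuous_quad.comp (continuous_const.prodMk continuous_id)
  have hfc : Continuous f := by fun_prop
  have hS : MeasurableSet (Θ ∩ Metric.ball θs δ) := h.measurableSet.inter measurableSet_ball
  obtain ⟨K, hK⟩ := eventually_atTop.1 (hpa.and h.sqrt_size_pos)
  have hbound : Integrable fun t : EuclideanSpace ℝ (Fin d) =>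
      |D| * ((1 + ‖t‖) * Real.exp (-b * ‖t‖ ^ 2)) + (1 + ‖t‖) * |f t| := by
    refine ((integrable_one_add_norm_mul_exp_neg_mul_norm_sq hb).const_mul _).add ?_
    refine ((integrable_one_add_norm_mul_exp_neg_quad hpd).const_mul
      (|(W θs).det ^ (-(1 / 2) : ℝ)| * |prior θs|)).congr (ae_of_all _ fun t => ?_)
    simp only [hf, abs_mul, Real.abs_exp]; ring
  -- Dominated convergence asks for measurability and the bound at every index; they are available
  -- only eventually, hence the shift.
  rw [← tendsto_add_atTop_iff_nat K]
  have hlim := tendsto_lintegral_of_dominated_convergence'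
    (μ := (volume : Measure (EuclideanSpace ℝ (Fin d))))
    (F := fun k t => ENNReal.ofReal ((1 + ‖t‖) *
      |localKernel (N (k + K)) (Θ ∩ Metric.ball θs δ) (M (k + K)) (V (k + K)) prior
        (τ (k + K)) t - f t|)) (f := fun _ => 0)
    (fun t => ENNReal.ofReal (|D| * ((1 + ‖t‖) * Real.exp (-b * ‖t‖ ^ 2)) + (1 + ‖t‖) * |f t|))
    (fun k => ?_) (fun k => ae_of_all _ fun t => ?_) hbound.lintegral_lt_top.ne
    (ae_of_all _ fun t => ?_)
  · rwa [lintegral_zero] at hlim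
  · have hm := h.aemeasurable_localKernel hS Set.inter_subset_left (hK (k + K) (by omega)).2
    have hn : AEMeasurable fun t : EuclideanSpace ℝ (Fin d) => 1 + ‖t‖ := by fun_prop
    exact (hn.mul (hm.sub hfc.aemeasurable).abs).ennreal_ofReal
  · apply ENNReal.ofReal_le_ofReal
    obtain ⟨h1, h2⟩ := hK (k + K) (by omega)
    have h3 : |localKernel (N (k + K)) (Θ ∩ Metric.ball θs δ) (M (k + K)) (V (k + K)) prior
        (τ (k + K)) t| ≤ |D| * Real.exp (-b * ‖t‖ ^ 2) := by
      rw [localKernel]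
      by_cases hθ : τ (k + K) + (Real.sqrt (N (k + K)))⁻¹ • t ∈ Θ ∩ Metric.ball θs δ
      · rw [Set.indicator_of_mem hθ]
        have h4 := hab h1 (hball _ hθ.2)
        dsimp only at h4
        rw [add_sub_cancel_left, smul_inv_smul₀ h2.ne'] at h4
        exact h4.trans (by gcongr; exact le_abs_self D)
      · rw [Set.indicator_of_notMem hθ, abs_zero]; positivity
    calc _ ≤ (1 + ‖t‖) * (|D| * Real.exp (-b * ‖t‖ ^ 2) + |f t|) := by
          gcongr
          exact (abs_sub _ _).trans (by gcongr)
      _ = _ := by ring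
  · have h1 : Tendsto (fun k => localKernel (N k) (Θ ∩ Metric.ball θs δ) (M k) (V k) prior
        (τ k) t) atTop (𝓝 (f t)) := by
      refine (h.tendsto_kernel t).congr' ?_
      filter_upwards [(h.tendsto_add_inv_sqrt_smul t).eventually
        (inter_mem h.mem_nhds (Metric.ball_mem_nhds _ hδ))] with k hk
      exact (Set.indicator_of_mem hk _).symm
    have h2 := (((h1.comp (tendsto_add_atTop_nat K)).sub_const (f t)).abs).const_mul (1 + ‖t‖)
    simpa using ENNReal.tendsto_ofReal h2

theorem tendsto_lintegral_localKernel (h : RegularPath Θ N M V τ m W prior p θs) :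
    Tendsto (fun k => ∫⁻ t, ENNReal.ofReal ((1 + ‖t‖) *
      |localKernel (N k) Θ (M k) (V k) prior (τ k) t -
        (W θs).det ^ (-(1 / 2) : ℝ) * Real.exp (-(quad (precision m W θs) t / 2)) *
        prior θs|)) atTop (𝓝 0) := by
  obtain ⟨δ, hδ, hnear⟩ := h.tendsto_lintegral_near
  have hsum := hnear.add (h.tendsto_lintegral_far hδ)
  rw [add_zero] at hsum
  refine tendsto_of_tendsto_of_tendsto_of_le_of_le' tendsto_const_nhds hsum
    (Eventually.of_forall fun _ => zero_le) ?_
  filter_upwards [h.sqrt_size_pos] with k hk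
  have hS : MeasurableSet (Θ \ Metric.ball θs δ) := h.measurableSet.diff measurableSet_ball
  have hm := h.aemeasurable_localKernel hS Set.sdiff_subset hk
  have hn : AEMeasurable fun t : EuclideanSpace ℝ (Fin d) => 1 + ‖t‖ := by fun_prop
  refine le_of_le_of_eq ?_ (lintegral_add_right' _ (hn.mul hm.abs).ennreal_ofReal)
  refine lintegral_mono fun t => ?_
  rw [← ENNReal.ofReal_add (by positivity) (by positivity), ← mul_add]
  apply ENNReal.ofReal_le_ofReal
  gcongr
  have hsplit : localKernel (N k) Θ (M k) (V k) prior (τ k) t =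
      localKernel (N k) (Θ ∩ Metric.ball θs δ) (M k) (V k) prior (τ k) t +
      localKernel (N k) (Θ \ Metric.ball θs δ) (M k) (V k) prior (τ k) t := by
    simp only [localKernel, Set.indicator, Set.mem_inter_iff, Set.mem_sdiff]
    split_ifs <;> simp_all
  rw [hsplit, add_sub_right_comm]
  exact abs_add_le _ _

/-! ### From the kernel to the normalised density -/

theorem localDensity_eq (hΘ : MeasurableSet Θ) {n : ℕ} (hn : 0 < Real.sqrt n)
    (M₁ : EuclideanSpace ℝ (Fin d) → EuclideanSpace ℝ (Fin d))
    (V₁ : EuclideanSpace ℝ (Fin d) → Matrix (Fin d) (Fin d) ℝ) (τ₁ : EuclideanSpace ℝ (Fin d))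
    {t : EuclideanSpace ℝ (Fin d)} (ht : t ∈ localSpace n Θ τ₁) :
    localDensity n Θ M₁ V₁ prior τ₁ t =
      localKernel n Θ M₁ V₁ prior τ₁ t / ∫ u, localKernel n Θ M₁ V₁ prior τ₁ u := by
  obtain ⟨θ, hθ, rfl⟩ := ht
  have h1 : τ₁ + (Real.sqrt n)⁻¹ • Real.sqrt n • (θ - τ₁) = θ := by
    rw [inv_smul_smul₀ hn.ne', add_sub_cancel]
  -- The Jacobian `√n ^ d` is the factor `n ^ (d / 2)` in `localDensity`.
  have h2 : ∫ u, localKernel n Θ M₁ V₁ prior τ₁ u =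
      Real.sqrt n ^ d * ∫ θ in Θ, kernel n M₁ V₁ prior θ := by
    simp only [localKernel]
    rw [integral_comp_add_inv_smul hn τ₁ (Θ.indicator (kernel n M₁ V₁ prior)),
      integral_indicator hΘ]
  have h3 : (n : ℝ) ^ ((d : ℝ) / 2) = Real.sqrt n ^ d := by
    rw [Real.sqrt_eq_rpow, ← Real.rpow_natCast, ← Real.rpow_mul (by positivity)]
    congr 1; ring
  rw [h2, localDensity, density, localKernel]
  dsimp only
  rw [h1, h3, Set.indicator_of_mem hθ, div_div, mul_comm]

/-- The deterministic form of the Bernstein–von Mises theorem for the Q-posterior. -/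
theorem tendsto_lintegral_localDensity (h : RegularPath Θ N M V τ m W prior p θs) {j : ℕ}
    (hj : j = 0 ∨ j = 1) :
    Tendsto (fun k => ∫⁻ t in localSpace (N k) Θ (τ k), ENNReal.ofReal (‖t‖ ^ j *
      |localDensity (N k) Θ (M k) (V k) prior (τ k) t -
        gaussianDensity 0 (precision m W θs)⁻¹ t|)) atTop (𝓝 0) := by
  have hpd := posDef_precision h.invertible h.weight_posDef
  have hdet := hpd.det_pos
  have hWdet := h.weight_posDef.det_pos
  have hpri := h.prior_pos
  set c₁ := Real.sqrt (precision m W θs).det / (2 * Real.pi) ^ ((d : ℝ) / 2) with hc₁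
  have hc₁0 : 0 < c₁ := by positivity
  have hgauss : ∀ t, gaussianDensity 0 (precision m W θs)⁻¹ t =
      Real.exp (-(quad (precision m W θs) t / 2)) * c₁ :=
    gaussianDensity_zero_inv_eq _ hpd
  have hgint : Integrable fun t : EuclideanSpace ℝ (Fin d) =>
      (1 + ‖t‖) * |gaussianDensity 0 (precision m W θs)⁻¹ t| := by
    refine ((integrable_one_add_norm_mul_exp_neg_quad hpd).mul_const c₁).congr
      (ae_of_all _ fun t => ?_)
    simp only [hgauss, abs_mul, Real.abs_exp, abs_of_pos hc₁0]; ring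
  have hqc : Continuous fun x : EuclideanSpace ℝ (Fin d) => quad (precision m W θs) x :=
    continuous_quad.comp (continuous_const.prodMk continuous_id)
  have hgc : Continuous fun t => gaussianDensity 0 (precision m W θs)⁻¹ t := by
    simp_rw [hgauss]; fun_prop
  have hg : Integrable fun t => gaussianDensity 0 (precision m W θs)⁻¹ t :=
    hgint.mono' hgc.aestronglyMeasurable (ae_of_all _ fun t => by
      rw [Real.norm_eq_abs]
      exact le_mul_of_one_le_left (abs_nonneg _) (by linarith [norm_nonneg t]))
  -- Here `c` is chosen so that `c * g` is the limit kernel, and the weight `1 + ‖t‖` dominates `‖t‖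
  -- ^ j` for both values of `j`.
  have hmain := tendsto_lintegral_normalised (μ := (volume : Measure (EuclideanSpace ℝ (Fin d))))
    (f := fun k => localKernel (N k) Θ (M k) (V k) prior (τ k))
    (g := gaussianDensity 0 (precision m W θs)⁻¹) (v := fun t => ‖t‖ ^ j)
    (w := fun t => 1 + ‖t‖) (c := (W θs).det ^ (-(1 / 2) : ℝ) * prior θs / c₁) (by positivity)
    (h.sqrt_size_pos.mono fun k hk =>
      (h.aemeasurable_localKernel h.measurableSet le_rfl hk).aestronglyMeasurable)
    hg (integral_gaussianDensity_zero_inv hpd) (fun t => by linarith [norm_nonneg t]) hgint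
    (fun t => by rcases hj with rfl | rfl <;> simp) ?_
  · refine tendsto_of_tendsto_of_tendsto_of_le_of_le' tendsto_const_nhds hmain
      (Eventually.of_forall fun _ => zero_le) ?_
    filter_upwards [h.sqrt_size_pos] with k hk
    have hT : MeasurableSet (localSpace (N k) Θ (τ k)) := by
      have : localSpace (N k) Θ (τ k) =
          (fun t => τ k + (Real.sqrt (N k))⁻¹ • t) ⁻¹' Θ := by
        ext t
        simp only [localSpace, Set.mem_image, Set.mem_preimage]
        constructor
        · rintro ⟨θ, hθ, rfl⟩
          rwa [inv_smul_smul₀ hk.ne', add_sub_cancel]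
        · exact fun ht => ⟨_, ht, by rw [add_sub_cancel_left, smul_inv_smul₀ hk.ne']⟩
      rw [this]
      exact (measurableEmbedding_add_inv_smul hk _).measurable h.measurableSet
    -- Passing to the whole space only adds the Gaussian tail outside the local space, where
    -- `localKernel` is `0`.
    refine (setLIntegral_congr_fun hT fun t ht => ?_).trans_le (setLIntegral_le_lintegral _ _)
    rw [localDensity_eq h.measurableSet hk _ _ _ ht]
  · refine h.tendsto_lintegral_localKernel.congr fun k => lintegral_congr fun t => ?_
    rw [hgauss]
    congr 4
    field_simp

end RegularPath

/-! ### From convergence in probability to sequences of outcomes -/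

/-- If the events `A n` do not become small, then a sequence of outcomes in them can be chosen that
eventually avoids each of countably many families of events of small total probability. -/
theorem exists_path_of_frequently {Ω : ℕ → Type*} [∀ n, MeasurableSpace (Ω n)]
    (P : ∀ n, Measure (Ω n)) {A : ∀ n, Set (Ω n)} {B : ℕ → ∀ n, Set (Ω n)} {a : ℝ≥0∞}
    {b : ℕ → ℝ≥0∞} (hA : ∃ᶠ n in atTop, a < P n (A n))
    (hB : ∀ j, ∀ᶠ n in atTop, P n (B j n) ≤ b j) (hb : ∑' j, b j ≤ a) :
    ∃ (N : ℕ → ℕ) (y : ∀ k, Ω (N k)), Tendsto N atTop atTop ∧ (∀ k, y k ∈ A (N k)) ∧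
      ∀ j, ∀ᶠ k in atTop, y k ∉ B j (N k) := by
  have key : ∀ k : ℕ, ∃ n, ∃ y : Ω n, k ≤ n ∧ y ∈ A n ∧ ∀ j ≤ k, y ∉ B j n := by
    intro k
    have h1 : ∀ᶠ n in atTop, ∀ j ∈ Finset.range (k + 1), P n (B j n) ≤ b j :=
      (Finset.range (k + 1)).eventually_all.2 fun j _ => hB j
    obtain ⟨n, hn, h2, h3⟩ := (hA.and_eventually (h1.and (eventually_ge_atTop k))).exists
    -- The bad events of levels `j ≤ k` cannot cover `A n`.
    have h4 : P n (⋃ j ∈ Finset.range (k + 1), B j n) < P n (A n) :=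
      ((measure_biUnion_finset_le _ _).trans ((Finset.sum_le_sum h2).trans
        ((ENNReal.sum_le_tsum _).trans hb))).trans_lt hn
    obtain ⟨y, hyA, hyB⟩ := Set.not_subset.1 fun h => h4.not_ge (measure_mono h)
    refine ⟨n, y, h3, hyA, fun j hj hjB => hyB ?_⟩
    simp only [Set.mem_iUnion]
    exact ⟨j, Finset.mem_range.2 (by omega), hjB⟩
  choose N y hN hyA hyB using key
  exact ⟨N, y, tendsto_atTop_mono hN tendsto_id, hyA,
    fun j => eventually_atTop.2 ⟨j, fun k hk => hyB k j hk⟩⟩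

theorem IsLittleOp.eventually_le {Ω : ℕ → Type*} [∀ n, MeasurableSpace (Ω n)]
    {P : ∀ n, Measure (Ω n)} {X : ∀ n, Ω n → ℝ≥0∞} (hX : IsLittleOp P X) {ε : ℝ} (hε : 0 < ε) :
    ∀ᶠ n in atTop, P n {y | ENNReal.ofReal ε < X n y} ≤ ENNReal.ofReal ε :=
  ENNReal.tendsto_nhds_zero.1 (hX ε hε) _ (ENNReal.ofReal_pos.2 hε)

/-- Sequences that converge in distribution are tight. -/
theorem exists_eventually_measure_norm_gt_le {Ω : ℕ → Type*} [∀ n, MeasurableSpace (Ω n)]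
    {P : ∀ n, Measure (Ω n)} [∀ n, IsProbabilityMeasure (P n)] {E Ω' : Type*}
    [NormedAddCommGroup E] [ProperSpace E] [MeasurableSpace E] [BorelSpace E]
    [SecondCountableTopology E] [MeasurableSpace Ω'] {μ : Measure Ω'} [IsProbabilityMeasure μ]
    {X : ∀ n, Ω n → E} {Z : Ω' → E} (h : TendstoInDistribution X atTop Z P μ) {ε : ℝ}
    (hε : 0 < ε) :
    ∃ K : ℝ, ∀ᶠ n in atTop, P n {y | K < ‖X n y‖} ≤ ENNReal.ofReal ε := by
  have : IsProbabilityMeasure (μ.map Z) :=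
    Measure.isProbabilityMeasure_map h.aemeasurable_limit
  have h1 := tendsto_measure_norm_gt_of_isTightMeasureSet
    (isTightMeasureSet_singleton (μ := μ.map Z))
  simp only [Set.mem_singleton_iff, iSup_iSup_eq_left] at h1
  obtain ⟨K, hK⟩ := (h1.eventually_lt_const (ENNReal.ofReal_pos.2 hε)).exists
  -- One unit of room puts a closed tail, to which the portmanteau bound applies, inside the open
  -- tail `K < ‖x‖`.
  refine ⟨K + 1, ?_⟩
  have hF : IsClosed {x : E | K + 1 ≤ ‖x‖} := isClosed_le continuous_const continuous_norm
  have h2 := ProbabilityMeasure.limsup_measure_closed_le_of_tendsto h.tendsto hF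
  have h3 : (μ.map Z) {x : E | K + 1 ≤ ‖x‖} < ENNReal.ofReal ε :=
    (measure_mono fun x (hx : K + 1 ≤ ‖x‖) => show K < ‖x‖ by linarith).trans_lt hK
  filter_upwards [eventually_lt_of_limsup_lt (h2.trans_lt h3)] with n hn
  refine le_trans ?_ hn.le
  refine le_trans (measure_mono fun y (hy : K + 1 < ‖X n y‖) => ?_)
    (Measure.le_map_apply (h.forall_aemeasurable n) _)
  exact hy.le

theorem not_ofReal_lt_iSup_enorm {α E : Type*} [SeminormedAddGroup E] {s : Set α} {f : α → E}
    {ε : ℝ} (hε : 0 ≤ ε) (h : ¬ ENNReal.ofReal ε < ⨆ x ∈ s, ‖f x‖ₑ) : ∀ x ∈ s, ‖f x‖ ≤ ε := by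
  intro x hx
  have h1 : ‖f x‖ₑ ≤ ENNReal.ofReal ε := (le_iSup₂ x hx).trans (not_lt.1 h)
  rwa [← ofReal_norm, ENNReal.ofReal_le_ofReal_iff hε] at h1

end QPosterior

end

/-! ### Transfer from paths to convergence in probability -/

theorem theorem1 {d : ℕ}
    {Ω : ℕ → Type*} [∀ n, MeasurableSpace (Ω n)]
    (P : ∀ n, Measure (Ω n)) [∀ n, IsProbabilityMeasure (P n)]
    (Θ : Set (EuclideanSpace ℝ (Fin d))) (hΘ : MeasurableSet Θ)
    (mbar : ∀ n, Ω n → EuclideanSpace ℝ (Fin d) → EuclideanSpace ℝ (Fin d))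
    (hmbar : ∀ n y, AEMeasurable (mbar n y) (volume.restrict Θ))
    (Wn : ∀ n, Ω n → EuclideanSpace ℝ (Fin d) → Matrix (Fin d) (Fin d) ℝ)
    (hWn : ∀ n y i j, AEMeasurable (fun θ => Wn n y θ i j) (volume.restrict Θ))
    (m : EuclideanSpace ℝ (Fin d) → EuclideanSpace ℝ (Fin d))
    (W : EuclideanSpace ℝ (Fin d) → Matrix (Fin d) (Fin d) ℝ)
    (prior : EuclideanSpace ℝ (Fin d) → ℝ) (p : ℝ)
    (θs : EuclideanSpace ℝ (Fin d))
    (hscore : QPosterior.ScoreRegular P Θ mbar m θs)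
    (hweight : QPosterior.WeightRegular P Θ Wn m W θs)
    (hprior : QPosterior.PriorRegular P Θ Wn prior p θs)
    (hunique : ∀ θ ∈ Θ, m θ = 0 → θ = θs)
    (θn : ∀ n, Ω n → EuclideanSpace ℝ (Fin d)) (hθn : ∀ n y, θn n y ∈ Θ)
    (hroot : QPosterior.IsLittleOp P fun n y => ‖Real.sqrt n • mbar n y (θn n y)‖ₑ) :
    ∀ k : ℕ, k = 0 ∨ k = 1 →
      QPosterior.IsLittleOp P fun n y =>
        ∫⁻ t in QPosterior.localSpace n Θ (θn n y),
          ENNReal.ofReal (‖t‖ ^ k *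
            |QPosterior.localDensity n Θ (mbar n y) (Wn n y) prior (θn n y) t -
              QPosterior.gaussianDensity 0 (QPosterior.precision m W θs)⁻¹ t|) := by
  intro i hi ε hε
  rw [ENNReal.tendsto_nhds_zero]
  by_contra hcon
  push Not at hcon
  obtain ⟨a, ha, hfreq⟩ := hcon
  obtain ⟨α, hα0, hαa⟩ : ∃ α : ℝ, 0 < α ∧ ENNReal.ofReal α ≤ a := by
    refine ⟨(min a 1).toReal, ENNReal.toReal_pos (by simp [ha.ne'])
      (min_lt_of_right_lt ENNReal.one_lt_top).ne, ?_⟩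
    exact ENNReal.ofReal_toReal_le.trans (min_le_left _ _)
  -- Level `j` has seven bad events, each of probability at most `ρ j` eventually, and `∑ 7 ρ j =
  -- α`.
  set ρ : ℕ → ℝ := fun j => α / 14 * (1 / 2) ^ j with hρ
  have hρ0 : ∀ j, 0 < ρ j := fun j => by positivity
  have hρsum : ∑' j, 7 * ENNReal.ofReal (ρ j) = ENNReal.ofReal α := by
    have hs : HasSum (fun j => 7 * ρ j) α := by
      have := (hasSum_geometric_two.mul_left (α / 14)).mul_left 7
      rwa [show 7 * (α / 14 * 2) = α by ring] at this
    rw [← hs.tsum_eq, ENNReal.ofReal_tsum_of_nonneg (fun j => by have := hρ0 j; positivity)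
      hs.summable]
    refine tsum_congr fun j => ?_
    rw [ENNReal.ofReal_mul (p := 7) (by norm_num)]
    congr 1
    norm_num
  have hρlim : ∀ e : ℝ, 0 < e → ∃ j, ρ j ≤ e := fun e he => by
    have : Tendsto ρ atTop (𝓝 (α / 14 * 0)) :=
      (tendsto_pow_atTop_nhds_zero_of_lt_one (by norm_num) (by norm_num)).const_mul _
    rw [mul_zero] at this
    exact (this.eventually_le_const he).exists
  obtain ⟨δW, hδW, hWprob, hWcont, hWpd⟩ := hweight.near
  obtain ⟨I, -, hclt⟩ := hscore.clt
  choose δ hδ hequi using fun j => hscore.equicont (ρ j) (hρ0 j)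
  choose C hC using fun j => hprior.moment_weighted (ρ j) (hρ0 j)
  choose K hK using fun j => QPosterior.exists_eventually_measure_norm_gt_le hclt (hρ0 j)
  set B₁ : ℕ → ∀ n, Set (Ω n) := fun j n =>
    {y | ENNReal.ofReal (ρ j) < ⨆ θ ∈ Θ, ‖mbar n y θ - m θ‖ₑ} with hB₁
  set B₂ : ∀ n, Set (Ω n) := fun n => {y | ¬ ((∀ θ ∈ Θ, (Wn n y θ).PosSemidef) ∧
    ∀ θ ∈ Θ ∩ Metric.closedBall θs δW, (Wn n y θ).PosDef)} with hB₂
  set B₃ : ℕ → ∀ n, Set (Ω n) := fun j n =>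
    {y | ENNReal.ofReal (ρ j) < ⨆ θ ∈ Θ, ‖Wn n y θ - W θ‖ₑ} with hB₃
  set B₄ : ℕ → ∀ n, Set (Ω n) := fun j n =>
    {y | ENNReal.ofReal (ρ j) < ⨆ θ ∈ Θ ∩ Metric.ball θs (δ j),
      ENNReal.ofReal (Real.sqrt n * ‖(mbar n y θ - mbar n y θs) - (m θ - m θs)‖ /
        (1 + Real.sqrt n * ‖θ - θs‖))} with hB₄
  set B₅ : ℕ → ∀ n, Set (Ω n) := fun j n =>
    {y | ENNReal.ofReal (C j) < ∫⁻ θ in Θ, ENNReal.ofReal (Wn n y θ).det ^ (-(1 / 2) : ℝ) *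
      ENNReal.ofReal (‖θ - θs‖ ^ p * prior θ)} with hB₅
  set B₆ : ℕ → ∀ n, Set (Ω n) := fun j n =>
    {y | ENNReal.ofReal (ρ j) < ‖Real.sqrt n • mbar n y (θn n y)‖ₑ} with hB₆
  set B₇ : ℕ → ∀ n, Set (Ω n) := fun j n => {y | K j < ‖Real.sqrt n • mbar n y θs‖} with hB₇
  have hB : ∀ j, ∀ᶠ n in atTop, P n (B₁ j n ∪ B₂ n ∪ B₃ j n ∪ B₄ j n ∪ B₅ j n ∪ B₆ j n ∪ B₇ j n) ≤
      7 * ENNReal.ofReal (ρ j) := by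
    intro j
    filter_upwards [hscore.ulln.eventually_le (hρ0 j),
      ENNReal.tendsto_nhds_zero.1 hWprob _ (ENNReal.ofReal_pos.2 (hρ0 j)),
      hweight.consistent.eventually_le (hρ0 j), eventually_lt_of_limsup_lt (hequi j), hC j,
      hroot.eventually_le (hρ0 j), hK j] with n h1 h2 h3 h4 h5 h6 h7
    have := (measure_union_le _ _).trans (add_le_add ((measure_union_le _ _).trans (add_le_add
      ((measure_union_le _ _).trans (add_le_add ((measure_union_le _ _).trans (add_le_add
      ((measure_union_le _ _).trans (add_le_add ((measure_union_le _ _).trans (add_le_add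
      h1 h2)) h3)) h4.le)) h5)) h6)) h7)
    refine this.trans_eq ?_
    ring
  obtain ⟨N, y, hN, hyA, hyB⟩ := QPosterior.exists_path_of_frequently P
    hfreq hB (hρsum.trans_le hαa)
  simp only [Set.mem_union, not_or] at hyB
  have hΘn : Θ ∈ 𝓝 θs := mem_interior_iff_mem_nhds.1 hscore.mem_interior
  have hWn' : Θ ∩ Metric.closedBall θs δW ∈ 𝓝 θs :=
    inter_mem hΘn (Metric.closedBall_mem_nhds _ hδW)
  have hpath : QPosterior.RegularPath Θ N (fun k => mbar (N k) (y k)) (fun k => Wn (N k) (y k))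
      (fun k => θn (N k) (y k)) m W prior p θs :=
    { measurableSet := hΘ
      aemeasurable_score := fun k => hmbar _ _
      aemeasurable_weight := fun k => hWn _ _
      tendsto_size := hN
      mem_interior := hscore.mem_interior
      root := hscore.root
      strict := by
        obtain ⟨r, hr, hm⟩ := hscore.contDiff
        exact (hm.contDiffAt (Metric.closedBall_mem_nhds _ hr)).hasStrictFDerivAt one_ne_zero
      invertible := hscore.invertible
      weight_continuousAt := hWcont.continuousAt hWn'
      weight_posDef := hWpd _ (mem_of_mem_nhds hWn')
      weight_posSemidef := hweight.posSemidef
      identified := fun e he => by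
        obtain ⟨η, hη, c, hc, h⟩ := hweight.identified e he
        refine ⟨η, by exact_mod_cast hη, c, hc, fun θ hθ hθe => ?_⟩
        -- In `WeightRegular.identified` the scalar `η` elaborates to a natural number. This is
        -- equivalent to a real `η > 0`: for `η ≤ 1` and `W ≥ 0`, `(W + I)⁻¹ ≥ η (W + η I)⁻¹`, so
        -- only `c` changes.
        rw [Nat.cast_smul_eq_nsmul]
        exact h θ hθ hθe
      prior_nonneg := hprior.nonneg
      prior_continuousOn := hprior.continuousOn
      prior_pos := hprior.pos
      one_le := hprior.one_le
      center_mem := fun k => hθn _ _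
      ulln := fun e he => by
        obtain ⟨j, hj⟩ := hρlim e he
        filter_upwards [hyB j] with k hk θ hθ
        exact (QPosterior.not_ofReal_lt_iSup_enorm (hρ0 j).le hk.1.1.1.1.1.1 θ hθ).trans hj
      posSemidef := by
        filter_upwards [hyB 0] with k hk
        exact (not_not.1 hk.1.1.1.1.1.2).1
      consistent := fun e he => by
        obtain ⟨j, hj⟩ := hρlim e he
        filter_upwards [hyB j] with k hk θ hθ
        exact (QPosterior.not_ofReal_lt_iSup_enorm (hρ0 j).le hk.1.1.1.1.2 θ hθ).trans hj
      equicont := fun e he => by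
        obtain ⟨j, hj⟩ := hρlim e he
        refine ⟨δ j, hδ j, ?_⟩
        filter_upwards [hyB j] with k hk θ hθ
        have h1 := (le_iSup₂ (f := fun θ (_ : θ ∈ Θ ∩ Metric.ball θs (δ j)) =>
          ENNReal.ofReal (Real.sqrt (N k) * ‖(mbar (N k) (y k) θ - mbar (N k) (y k) θs) -
            (m θ - m θs)‖ / (1 + Real.sqrt (N k) * ‖θ - θs‖))) θ hθ).trans (not_lt.1 hk.1.1.1.2)
        rw [ENNReal.ofReal_le_ofReal_iff (hρ0 j).le, div_le_iff₀ (by positivity)] at h1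
        exact h1.trans (by gcongr)
      moment := ⟨C 0, (hyB 0).mono fun k hk => not_lt.1 hk.1.1.2⟩
      approx_root := fun e he => by
        obtain ⟨j, hj⟩ := hρlim e he
        filter_upwards [hyB j] with k hk
        have h1 : ‖Real.sqrt (N k) • mbar (N k) (y k) (θn (N k) (y k))‖ₑ ≤
          ENNReal.ofReal (ρ j) := not_lt.1 hk.1.2
        rw [← ofReal_norm, ENNReal.ofReal_le_ofReal_iff (hρ0 j).le] at h1
        exact h1.trans hj
      tight := ⟨K 0, (hyB 0).mono fun k hk => not_lt.1 hk.2⟩ }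
  have hlim := hpath.tendsto_lintegral_localDensity hi
  obtain ⟨k, hk⟩ := (hlim.eventually_lt_const (ENNReal.ofReal_pos.2 hε)).exists
  exact hk.not_gt (hyA k)
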